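/- Consider the monocular visual-inertial odometry (VIO) system with state $\gamma\in\mathbb R^2$ (landmark direction in the camera frame), $\rho$ (inverse depth), $\mathbf v,\mathbf g\in\mathbb R^3$ (velocity and gravity in the body frame), constant parameters $\theta=(\mathbf b_g,\mathbf b_a,M_g,T_s,M_a,\mathbf p_{CB},\mathbf q_{CB},f_x,f_y,c_x,c_y,k_1,k_2,p_1,p_2)$ with $M_a$ lower triangular, and input $\mathbf u=(\mathbf a_m,\boldsymbol\omega_m)$, a smooth function of the IMU time. With $\mathbf a_t=M_a(\mathbf a_m-\mathbf b_a)$, $\boldsymbol\omega_t=M_g(\boldsymbol\omega_m-\mathbf b_g)-M_gT_s(\mathbf a_m-\mathbf b_a)$, $\bar\gamma=(\gamma,1)$ and $R$ the rotation of $\mathbf q_{CB}$, the dynamics is $$\begin{bmatrix}\dot\gamma\\ \dot\rho\end{bmatrix}=\begin{bmatrix}I_2&-\gamma\\0&-\rho\end{bmatrix}\big[(R\boldsymbol\omega_t)\times(\rho\,\mathbf p_{CB}-\bar\gamma)-\rho R\mathbf v\big],\quad \dot{\mathbf v}=\mathbf v\times\boldsymbol\omega_t+\mathbf a_t+\mathbf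 g,\quad \dot{\mathbf g}=\mathbf g\times\boldsymbol\omega_t .$$ The observation $\mathbf h(\mathbf x)$ is the image point (column, row) of $\gamma$ under the pinhole radial-tangential camera model, either alone or together with $|\mathbf g|^2$ and $|\mathbf q_{CB}|^2$. The camera has a rolling shutter, an unknown time offset $t_d$, image height $h>0$ and an unknown frame readout time $t_r$: the record $\mathbf y$, a continuous function of the camera time $t$ with row coordinate $v(t)$, satisfies $$\mathbf y(t)=\mathbf h\big(\mathbf x(t+t_d+(v(t)/h-\kappa)\,t_r)\big),$$ where $\kappa h$ is the reference row ($\kappa=\tfrac12$: central row; $\kappa=0$: $t+t_d+v(t)\,d$ with the line delay $d=t_r/h$). The full state $\xi$ consists of $(\gamma,\rho,\mathbf v,\mathbf g)$ at the time of the first observation, $\theta$, $t_d$ and $t_r$. Given $\mathbf u$ and a record $\mathbf y$ of $\xi$ on $[t_0,t_0+T]$, the readout time is called weakly observable at $\xi$ if some neighbourhood of $\xi$ contains no full state that has a different readout time and produces the same record $\mathbf y$ on $[t_0,t_0+T]$ under the same input $\mathbf u$. (a) The readout time (equivalently, the line delay) is weakly observable in general: for every full state $\xi$ with $\rho>0$,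 $|\mathbf q_{CB}|=1$, $M_g$ and $M_a$ invertible and $f_x,f_y>0$, there is a meagre set of inputs in $C^\infty(\mathbb R,\mathbb R^6)$ such that for every input $\mathbf u$ outside it, every $T>0$ and every record $\mathbf y$ of $\xi$ under $\mathbf u$ on $[t_0,t_0+T]$, the readout time is weakly observable at $\xi$. (b) Trivially constant observations are an exception: for every full state $\xi$, every smooth input and every $T>0$, if a record $\mathbf y$ of $\xi$ on $[t_0,t_0+T]$ is constant, then the readout time is not weakly observable at $\xi$ from it. -/

import Mathlib

open Set Filter Topology Matrix
open scoped ContDiff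

noncomputable section

namespace RSVIO

/-! ### The state of the visual-inertial system -/

/-- Vectors of `ℝ³`. -/
abbrev V3 := Fin 3 → ℝ

/-- The time-varying part of the state: direction `γ` and inverse depth `ρ` of the landmark in the
camera frame, velocity `v` and gravity vector `g` in the body frame. -/
abbrev NavState := (Fin 2 → ℝ) × ℝ × V3 × V3

namespace NavState
/-- Direction `γ = (p_x / p_z, p_y / p_z)` of the landmark in the camera frame. -/
abbrev γ (x : NavState) : Fin 2 → ℝ := x.1
/-- Inverse depth `ρ = 1 / p_z` of the landmark in the camera frame. -/
abbrev ρ (x : NavState) : ℝ := x.2.1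
/-- Velocity in the body frame. -/
abbrev v (x : NavState) : V3 := x.2.2.1
/-- Gravity in the body frame. -/
abbrev g (x : NavState) : V3 := x.2.2.2
end NavState

/-- The constant part of the state: biases `b_g`, `b_a`, the matrices `M_g`, `T_s`, the six entries
of the lower triangular `M_a`, the camera extrinsics `p_CB`, `q_CB`, and the eight parameters
`f_x, f_y, c_x, c_y, k_1, k_2, p_1, p_2` of the pinhole radial-tangential camera. -/
abbrev Calib :=
  V3 × V3 × Matrix (Fin 3) (Fin 3) ℝ × Matrix (Fin 3) (Fin 3) ℝ × (Fin 6 → ℝ) ×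
    V3 × (Fin 4 → ℝ) × (Fin 8 → ℝ)

namespace Calib
/-- Gyroscope bias. -/
abbrev bg (θ : Calib) : V3 := θ.1
/-- Accelerometer bias. -/
abbrev ba (θ : Calib) : V3 := θ.2.1
/-- Gyroscope scale, misalignment and orientation matrix. -/
abbrev Mg (θ : Calib) : Matrix (Fin 3) (Fin 3) ℝ := θ.2.2.1
/-- Gyroscope `g`-sensitivity matrix. -/
abbrev Ts (θ : Calib) : Matrix (Fin 3) (Fin 3) ℝ := θ.2.2.2.1
/-- The six free entries of the accelerometer matrix. -/
abbrev maVec (θ : Calib) : Fin 6 → ℝ := θ.2.2.2.2.1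
/-- Accelerometer scale and misalignment matrix (lower triangular). -/
def Ma (θ : Calib) : Matrix (Fin 3) (Fin 3) ℝ :=
  !![θ.maVec 0, 0, 0;
     θ.maVec 1, θ.maVec 2, 0;
     θ.maVec 3, θ.maVec 4, θ.maVec 5]
/-- Position of the body origin in the camera frame. -/
abbrev pCB (θ : Calib) : V3 := θ.2.2.2.2.2.1
/-- The quaternion `q_CB = (q_w, q_x, q_y, q_z)`. -/
abbrev qCB (θ : Calib) : Fin 4 → ℝ := θ.2.2.2.2.2.2.1
/-- The camera intrinsics `(f_x, f_y, c_x, c_y, k_1, k_2, p_1, p_2)`. -/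
abbrev intr (θ : Calib) : Fin 8 → ℝ := θ.2.2.2.2.2.2.2

/-- The matrix of the quaternion `q_CB`; it is the rotation `R_CB` when `q_CB` is a unit
quaternion. -/
def RCB (θ : Calib) : Matrix (Fin 3) (Fin 3) ℝ :=
  let w := θ.qCB 0
  let x := θ.qCB 1
  let y := θ.qCB 2
  let z := θ.qCB 3
  !![w ^ 2 + x ^ 2 - y ^ 2 - z ^ 2, 2 * (x * y - w * z), 2 * (x * z + w * y);
     2 * (x * y + w * z), w ^ 2 - x ^ 2 + y ^ 2 - z ^ 2, 2 * (y * z - w * x);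
     2 * (x * z - w * y), 2 * (y * z + w * x), w ^ 2 - x ^ 2 - y ^ 2 + z ^ 2]
end Calib

/-- The full unknown state: the navigation state at the first observation, the constant parameters,
the camera time offset `t_d`, and the frame readout time `t_r`. -/
abbrev FullState := NavState × Calib × ℝ × ℝ

namespace FullState
/-- Navigation state at the first observation. -/
abbrev nav (ξ : FullState) : NavState := ξ.1
/-- IMU parameters, camera extrinsics and intrinsics. -/
abbrev cal (ξ : FullState) : Calib := ξ.2.1
/-- Time offset of the camera clock relative to the IMU clock. -/
abbrev td (ξ : FullState) : ℝ := ξ.2.2.1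
/-- Frame readout time. -/
abbrev tr (ξ : FullState) : ℝ := ξ.2.2.2
end FullState

/-! ### Control inputs: smooth IMU readings -/

/-- Values of the control input: the accelerometer reading `a_m` and the gyroscope reading `ω_m`. -/
abbrev Input := V3 × V3

/-- Smooth control inputs, as functions of the IMU time. -/
structure SmoothInput where
  /-- The input as a function of the IMU time. -/
  val : ℝ → Input
  smooth : ContDiff ℝ ∞ val

/-- The `k`-th derivative of a smooth input, as a continuous map. -/
def SmoothInput.deriv (u : SmoothInput) (k : ℕ) : C(ℝ, Input) :=
  ⟨iteratedDeriv k u.val, u.smooth.continuous_iteratedDeriv k (by exact_mod_cast le_top)⟩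

/-- The `C^∞` topology: locally uniform convergence of all derivatives. -/
instance SmoothInput.instTopology : TopologicalSpace SmoothInput :=
  TopologicalSpace.induced SmoothInput.deriv inferInstance

/-! ### The dynamics -/

/-- Calibrated acceleration `a_t = M_a (a_m - b_a)`. -/
def accel (θ : Calib) (u : Input) : V3 := θ.Ma *ᵥ (u.1 - θ.ba)

/-- Calibrated angular rate `ω_t = M_g (ω_m - b_g) - M_g T_s (a_m - b_a)`. -/
def angRate (θ : Calib) (u : Input) : V3 :=
  θ.Mg *ᵥ (u.2 - θ.bg) - θ.Mg *ᵥ (θ.Ts *ᵥ (u.1 - θ.ba))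

/-- The vector `ρ ṗ`, with `p` the landmark in the camera frame:
`(R_CB ω_t) × (ρ p_CB - (γ, 1)) - R_CB ρ v`. -/
def landmarkRate (θ : Calib) (x : NavState) (u : Input) : V3 :=
  (θ.RCB *ᵥ angRate θ u) ⨯₃ (x.ρ • θ.pCB - ![x.γ 0, x.γ 1, 1]) - x.ρ • (θ.RCB *ᵥ x.v)

/-- The right-hand side of the system; the constant parameters have derivative zero. -/
def dyn (θ : Calib) (x : NavState) (u : Input) : NavState :=
  (![landmarkRate θ x u 0 - x.γ 0 * landmarkRate θ x u 2,
     landmarkRate θ x u 1 - x.γ 1 * landmarkRate θ x u 2],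
   - x.ρ * landmarkRate θ x u 2,
   x.v ⨯₃ angRate θ u + accel θ u + x.g,
   x.g ⨯₃ angRate θ u)

/-! ### The observations -/

/-- Column coordinate of the landmark's image (pinhole radial-tangential model). -/
def imgCol (θ : Calib) (x : NavState) : ℝ :=
  let a := x.γ 0
  let b := x.γ 1
  let r2 := a ^ 2 + b ^ 2
  θ.intr 0 * (a * (1 + θ.intr 4 * r2 + θ.intr 5 * r2 ^ 2) + 2 * θ.intr 6 * a * b +
    θ.intr 7 * (r2 + 2 * a ^ 2)) + θ.intr 2

/-- Row coordinate of the landmark's image (pinhole radial-tangential model). -/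
def imgRow (θ : Calib) (x : NavState) : ℝ :=
  let a := x.γ 0
  let b := x.γ 1
  let r2 := a ^ 2 + b ^ 2
  θ.intr 1 * (b * (1 + θ.intr 4 * r2 + θ.intr 5 * r2 ^ 2) + θ.intr 6 * (r2 + 2 * b ^ 2) +
    2 * θ.intr 7 * a * b) + θ.intr 3

/-- The image observation alone: column and row. -/
def imageObs (θ : Calib) (x : NavState) : Fin 2 → ℝ := ![imgCol θ x, imgRow θ x]

/-- All observations: column, row, squared gravity magnitude, squared quaternion norm. -/
def fullObs (θ : Calib) (x : NavState) : Fin 4 → ℝ :=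
  ![imgCol θ x, imgRow θ x, x.g ⬝ᵥ x.g, θ.qCB ⬝ᵥ θ.qCB]

/-- IMU time at which a landmark that appears in row `v` at camera time `t` is observed:
`t + t_d + (v / H - κ) t_r`, where `H` is the image height and the row `κ H` is the one that is
exposed at camera time `t`. The choice `κ = 1 / 2` refers to the central row; `κ = 0`, `H = 1` gives
`t + t_d + v d`, with the line delay `d` in the place of `t_r`. -/
def rsTime (H κ : ℝ) (ξ : FullState) (t v : ℝ) : ℝ := t + ξ.td + (v / H - κ) * ξ.tr

section Observability

variable {n : ℕ} (h : Calib → NavState → Fin (n + 2) → ℝ) (H κ t₀ T : ℝ)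

/-- `y` is, for camera times in `[t₀, t₀ + T]`, a record of the observations `h` that the full state
`ξ` produces under the input `u`: some solution of the dynamics that is in the state `ξ.nav` at the
time of the first observation satisfies the rolling-shutter observation equation
`y t = h (x (t + t_d + (v t / H - κ) t_r))`, with `v t = y t 1` the row in the record itself. -/
def IsRecord (ξ : FullState) (u : SmoothInput) (y : ℝ → Fin (n + 2) → ℝ) : Prop :=
  ContinuousOn y (Icc t₀ (t₀ + T)) ∧
  ∃ (a b : ℝ) (x : ℝ → NavState),
    (∀ s ∈ Ioo a b, HasDerivAt x (dyn ξ.cal (x s) (u.val s)) s) ∧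
    (∀ t ∈ Icc t₀ (t₀ + T), rsTime H κ ξ t (y t 1) ∈ Ioo a b) ∧
    x (rsTime H κ ξ t₀ (y t₀ 1)) = ξ.nav ∧
    ∀ t ∈ Icc t₀ (t₀ + T), y t = h ξ.cal (x (rsTime H κ ξ t (y t 1)))

/-- The readout time is weakly observable at `ξ` from the input `u` and the record `y` on
`[t₀, t₀ + T]`: in some neighbourhood of `ξ`, no full state with another readout time produces the
same record under the same input. -/
def ReadoutWeaklyObservable (ξ : FullState) (u : SmoothInput) (y : ℝ → Fin (n + 2) → ℝ) : Prop :=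
  ∃ N ∈ 𝓝 ξ, ∀ ξ' ∈ N, IsRecord h H κ t₀ T ξ' u y → ξ'.tr = ξ.tr

/-- The readout time is weakly observable at `ξ` for generic inputs: all smooth inputs outside a
meagre set determine it locally, from the observations on any time interval, however short. -/
def ReadoutGenericallyObservable (ξ : FullState) : Prop :=
  ∀ᶠ u in residual SmoothInput, ∀ T : ℝ, 0 < T → ∀ y : ℝ → Fin (n + 2) → ℝ,
    IsRecord h H κ t₀ T ξ u y → ReadoutWeaklyObservable h H κ t₀ T ξ u y

/-- The readout time is not weakly observable from a record that is constant. -/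
def ReadoutUnobservableIfConstant (ξ : FullState) : Prop :=
  ∀ (u : SmoothInput) (T : ℝ), 0 < T → ∀ y : ℝ → Fin (n + 2) → ℝ,
    IsRecord h H κ t₀ T ξ u y → (∀ t ∈ Icc t₀ (t₀ + T), y t = y t₀) →
      ¬ ReadoutWeaklyObservable h H κ t₀ T ξ u y

end Observability

/-- States of an actual sensor rig: the landmark is in front of the camera at finite depth, the
quaternion has norm one, the scale and misalignment matrices of the IMU are invertible, and the focal
lengths are positive. -/
structure FullState.Regular (ξ : FullState) : Prop where
  depth : 0 < ξ.nav.ρ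
  quat : ξ.cal.qCB ⬝ᵥ ξ.cal.qCB = 1
  gyro : ξ.cal.Mg.det ≠ 0
  acc : ξ.cal.Ma.det ≠ 0
  focal_x : 0 < ξ.cal.intr 0
  focal_y : 0 < ξ.cal.intr 1

end RSVIO

end

/-! Part (a) is a Baire category argument resting on a dimension count. Adjoin the constant
parameters to the navigation state, so that a solution with any calibration is a curve in one
finite-dimensional space `AugState`. Let `Y` be the solution of the given state and `Z` that of a
competitor with the same record. Eliminating the camera time leaves `col (Y s) = col (Z (φ s))` with
`φ s = s + c + d * row (Y s)`, where `d` is the difference of the readout times divided by the image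
height. Suppose `d ≠ 0`. Either `φ` moves some time, and then `φ` maps a short interval `[p, q]`
into an interval `[p', q']` disjoint from it; or `φ` is the identity on an interval, and then the
row of `Y` is constant there.

Each alternative, with rational endpoints and integer bounds, confines the input to a closed set
with empty interior, so a meagre set covers all cases. Closedness comes from Arzelà–Ascoli: bounded
Lipschitz curves form a compact set, and being a solution is a closed condition
(`isClosed_matchedInputs`, `isClosed_constantRowInputs`). For the empty interior, change the input
on `[p, q]` only. The solutions on `[p', q']` do not notice, so `N` image samples of `Y` in `[p, q]`
that match some `Z` are described by the initial value of `Z`, by `c` and `d`, and by the `N` rows.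
This set has Hausdorff dimension at most `finrank + 2 + N`, which is less than `2 * N` for large `N`
(`dense_compl_matchedSamples`). But the `N` samples can be moved off any set with dense complement
(`samplesPerturbable`): an accelerometer perturbation bends the velocity, which at nonzero inverse
depth steers the landmark direction freely, and the camera model is locally invertible on a dense
set of directions.

In part (b) the row is constant, so the time offset absorbs any change of the readout time. -/

noncomputable section

namespace RSVIO

/-! ### The topology on inputs and compact families of curves. -/

namespace SmoothInput

theorem continuous_deriv (k : ℕ) : Continuous fun u : SmoothInput => u.deriv k :=
  have h : Continuous (SmoothInput.deriv : SmoothInput → ℕ → C(ℝ, Input)) :=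
    continuous_induced_dom
  (continuous_apply k).comp h

theorem continuous_eval : Continuous fun p : SmoothInput × ℝ => p.1.val p.2 := by
  have h : Continuous fun p : SmoothInput × ℝ => (p.1.deriv 0) p.2 :=
    ((continuous_deriv 0).comp continuous_fst).eval continuous_snd
  simpa [SmoothInput.deriv] using h

/-- Serves the continuity of integrals that depend on the input as a parameter. -/
instance : FirstCountableTopology SmoothInput :=
  TopologicalSpace.firstCountableTopology_induced _ _ SmoothInput.deriv

theorem continuous_val (u : SmoothInput) : Continuous u.val := u.smooth.continuous

end SmoothInput

/-- Functions with Lipschitz constant `M` and values in `C`. -/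
def lipCurves {W : Type*} [PseudoMetricSpace W] (C : Set W) (M : NNReal) : Set C(ℝ, W) :=
  {Y | LipschitzWith M Y ∧ ∀ s, Y s ∈ C}

/-- Arzelà–Ascoli: a common Lipschitz constant gives equicontinuity, and pointwise the family is a
closed subset of the Tychonoff product of copies of `C`. -/
theorem isCompact_lipCurves {W : Type*} [PseudoMetricSpace W] {C : Set W} (hC : IsCompact C)
    (M : NNReal) : IsCompact (lipCurves C M) := by
  apply ArzelaAscoli.isCompact_of_equicontinuous
  · have : ContinuousMap.toFun '' lipCurves C M =
        {f : ℝ → W | ∀ s t, dist (f s) (f t) ≤ M * dist s t} ∩ univ.pi fun _ => C := by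
      ext f
      constructor
      · rintro ⟨Y, hY, rfl⟩
        exact ⟨fun s t => hY.1.dist_le_mul s t, fun s _ => hY.2 s⟩
      · rintro ⟨h1, h2⟩
        have hl : LipschitzWith M f := LipschitzWith.of_dist_le_mul h1
        exact ⟨⟨f, hl.continuous⟩, ⟨hl, fun s => h2 s trivial⟩, rfl⟩
    rw [this]
    refine (isCompact_univ_pi fun _ => hC).inter_left ?_
    simp only [ofPred_forall]
    refine isClosed_iInter fun s => isClosed_iInter fun t => isClosed_le ?_ continuous_const
    exact (continuous_apply s).dist (continuous_apply t)
  · refine (LipschitzWith.uniformEquicontinuous _ M fun Y => ?_).equicontinuous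
    exact Y.2.1

/-! ### Solutions of a controlled ODE: closedness, stability, uniqueness. -/

section Abstract

variable {W : Type*} [NormedAddCommGroup W] [NormedSpace ℝ W]

/-- `Y` solves the ODE `Y' = F (Y, u)` on the interval `[a, b]`. -/
def SolvesOn (F : W × Input → W) (u : SmoothInput) (a b : ℝ) (Y : ℝ → W) : Prop :=
  ∀ t ∈ Icc a b, HasDerivWithinAt Y (F (Y t, u.val t)) (Icc a b) t

variable {F : W × Input → W} {u : SmoothInput} {a b : ℝ} {Y Z : ℝ → W}

theorem SolvesOn.continuousOn (h : SolvesOn F u a b Y) : ContinuousOn Y (Icc a b) :=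
  fun t ht => (h t ht).continuousWithinAt

theorem SolvesOn.hasDerivAt (h : SolvesOn F u a b Y) {t : ℝ} (ht : t ∈ Ioo a b) :
    HasDerivAt Y (F (Y t, u.val t)) t :=
  (h t (Ioo_subset_Icc_self ht)).hasDerivAt (Icc_mem_nhds ht.1 ht.2)

theorem SolvesOn.hasDerivWithinAt_Ici (h : SolvesOn F u a b Y) {t : ℝ} (ht : t ∈ Ico a b) :
    HasDerivWithinAt Y (F (Y t, u.val t)) (Ici t) t :=
  (h t (Ico_subset_Icc_self ht)).mono_of_mem_nhdsWithin (Icc_mem_nhdsGE_of_mem ht)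

theorem SolvesOn.congr_input {w : SmoothInput} (h : SolvesOn F u a b Y)
    (hw : ∀ t ∈ Icc a b, w.val t = u.val t) : SolvesOn F w a b Y := fun t ht => by
  rw [hw t ht]; exact h t ht

/-- The integral form contains no derivative of `Y`, so it passes to limits in the compact-open
topology. -/
theorem solvesOn_iff_integral [CompleteSpace W] (hF : Continuous F) (hY : Continuous Y) :
    SolvesOn F u a b Y ↔
      ∀ t ∈ Icc a b, Y t - Y a - ∫ s in a..t, F (Y s, u.val s) = 0 := by
  have hc : Continuous fun s => F (Y s, u.val s) := hF.comp (hY.prodMk u.continuous_val)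
  constructor
  · intro h t ht
    rw [intervalIntegral.integral_eq_sub_of_hasDerivAt_of_le ht.1 hY.continuousOn
      (fun s hs => h.hasDerivAt ⟨hs.1, hs.2.trans_le ht.2⟩) (hc.intervalIntegrable _ _)]
    simp
  · intro h t ht
    have h1 : HasDerivAt (fun t => Y a + ∫ s in a..t, F (Y s, u.val s)) (F (Y t, u.val t)) t :=
      (intervalIntegral.integral_hasDerivAt_right (hc.intervalIntegrable _ _)
        (hc.stronglyMeasurableAtFilter _ _) hc.continuousAt).const_add _
    refine h1.hasDerivWithinAt.congr (fun s hs => ?_) ?_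
    · have := h s hs
      rw [sub_sub, sub_eq_zero] at this
      exact this
    · have := h t ht
      rw [sub_sub, sub_eq_zero] at this
      exact this

theorem isClosed_solvesOn [CompleteSpace W] (hF : Continuous F) (a b : ℝ) :
    IsClosed {p : SmoothInput × C(ℝ, W) | SolvesOn F p.1 a b p.2} := by
  simp only [solvesOn_iff_integral hF (ContinuousMap.continuous _), ofPred_forall]
  refine isClosed_iInter fun t => isClosed_iInter fun _ => isClosed_eq ?_ continuous_const
  have he : ∀ s : ℝ, Continuous fun p : SmoothInput × C(ℝ, W) => p.2 s := fun s =>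
    continuous_snd.eval continuous_const
  refine ((he t).sub (he a)).sub ?_
  apply intervalIntegral.continuous_parametric_intervalIntegral_of_continuous'
  refine hF.comp (Continuous.prodMk ?_ ?_)
  · exact (continuous_snd.comp continuous_fst).eval continuous_snd
  · exact SmoothInput.continuous_eval.comp
      ((continuous_fst.comp continuous_fst).prodMk continuous_snd)

/-- Projection along a compact factor is a closed map. This removes the existential quantifiers over
curves and shifts. -/
theorem isClosed_exists_of_isCompact {X Z : Type*} [TopologicalSpace X] [TopologicalSpace Z]
    {K : Set Z} (hK : IsCompact K) {R : Set (X × Z)} (hR : IsClosed R) :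
    IsClosed {x | ∃ z ∈ K, (x, z) ∈ R} := by
  have := isCompact_iff_compactSpace.mp hK
  have h := isClosedMap_fst_of_compactSpace (X := X) (Y := K) _
    (hR.preimage (continuous_id.prodMap continuous_subtype_val))
  convert h using 1
  ext x
  simp

/-- On a bounded set, the vector field is Lipschitz, uniformly in time. -/
theorem exists_lipschitzOnWith_closedBall [FiniteDimensional ℝ W] (hF : ContDiff ℝ 1 F)
    (u : SmoothInput) (a b R : ℝ) :
    ∃ K : NNReal, ∀ t ∈ Icc a b,
      LipschitzOnWith K (fun w => F (w, u.val t)) (Metric.closedBall 0 R) := by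
  have : ProperSpace W := FiniteDimensional.proper ℝ W
  obtain ⟨B, hB⟩ := (isCompact_Icc.image_of_continuousOn
    (f := u.val) (s := Icc a b) u.continuous_val.continuousOn).isBounded.subset_closedBall 0
  have hconv : Convex ℝ (Metric.closedBall (0 : W) R ×ˢ Metric.closedBall (0 : Input) B) :=
    (convex_closedBall _ _).prod (convex_closedBall _ _)
  have hcomp : IsCompact (Metric.closedBall (0 : W) R ×ˢ Metric.closedBall (0 : Input) B) :=
    (isCompact_closedBall _ _).prod (isCompact_closedBall _ _)
  obtain ⟨K, hK⟩ := hF.contDiffOn.exists_lipschitzOnWith one_ne_zero hconv hcomp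
  refine ⟨K, fun t ht => ?_⟩
  have hm : ∀ w ∈ Metric.closedBall (0 : W) R, (w, u.val t) ∈
      Metric.closedBall (0 : W) R ×ˢ Metric.closedBall (0 : Input) B := fun w hw =>
    ⟨hw, hB ⟨t, ht, rfl⟩⟩
  refine LipschitzOnWith.of_dist_le_mul fun x hx y hy => ?_
  have := hK.dist_le_mul _ (hm x hx) _ (hm y hy)
  simpa [Prod.dist_eq] using this

/-- Grönwall's inequality; it makes the solution a Lipschitz function of its initial value. -/
theorem SolvesOn.dist_le {K : NNReal} {R : ℝ}
    (hK : ∀ t ∈ Icc a b, LipschitzOnWith K (fun w => F (w, u.val t)) (Metric.closedBall 0 R))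
    (hY : SolvesOn F u a b Y) (hZ : SolvesOn F u a b Z)
    (hYR : ∀ t ∈ Icc a b, Y t ∈ Metric.closedBall 0 R)
    (hZR : ∀ t ∈ Icc a b, Z t ∈ Metric.closedBall 0 R) {t : ℝ} (ht : t ∈ Icc a b) :
    dist (Y t) (Z t) ≤ dist (Y a) (Z a) * Real.exp (K * (t - a)) :=
  dist_le_of_trajectories_ODE_of_mem (v := fun t w => F (w, u.val t))
    (s := fun _ => Metric.closedBall 0 R)
    (fun t ht => hK t (Ico_subset_Icc_self ht)) hY.continuousOn
    (fun _ ht => hY.hasDerivWithinAt_Ici ht) (fun t ht => hYR t (Ico_subset_Icc_self ht))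
    hZ.continuousOn
    (fun _ ht => hZ.hasDerivWithinAt_Ici ht) (fun t ht => hZR t (Ico_subset_Icc_self ht))
    le_rfl t ht

theorem SolvesOn.eqOn [FiniteDimensional ℝ W] (hF : ContDiff ℝ 1 F)
    (hY : SolvesOn F u a b Y) (hZ : SolvesOn F u a b Z) {s₀ : ℝ} (hs : s₀ ∈ Ioo a b)
    (h : Y s₀ = Z s₀) : EqOn Y Z (Icc a b) := by
  obtain ⟨R₁, h₁⟩ := (isCompact_Icc.image_of_continuousOn
    hY.continuousOn).isBounded.subset_closedBall 0
  obtain ⟨R₂, h₂⟩ := (isCompact_Icc.image_of_continuousOn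
    hZ.continuousOn).isBounded.subset_closedBall 0
  obtain ⟨K, hK⟩ := exists_lipschitzOnWith_closedBall hF u a b (max R₁ R₂)
  refine ODE_solution_unique_of_mem_Icc (v := fun t w => F (w, u.val t))
    (s := fun _ => Metric.closedBall 0 (max R₁ R₂)) (K := K)
    (fun t ht => hK t (Ioo_subset_Icc_self ht)) hs
    hY.continuousOn (fun _ ht => hY.hasDerivAt ht) (fun t ht => ?_)
    hZ.continuousOn (fun _ ht => hZ.hasDerivAt ht) (fun t ht => ?_) h
  · exact Metric.closedBall_subset_closedBall (le_max_left _ _)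
      (h₁ ⟨t, Ioo_subset_Icc_self ht, rfl⟩)
  · exact Metric.closedBall_subset_closedBall (le_max_right _ _)
      (h₂ ⟨t, Ioo_subset_Icc_self ht, rfl⟩)

end Abstract

/-! ### The dimension count for matched samples. -/

section Dimension

variable {W : Type*} [NormedAddCommGroup W] [NormedSpace ℝ W] [FiniteDimensional ℝ W]

/-- The samples `(col, row)` at the times `s i` that agree with the column observed on some solution
of the ODE at the times `s i + c + d * row`. -/
def matchedSamples (F : W × Input → W) (col : W → ℝ) (u : SmoothInput) (a b : ℝ) (Y : Set C(ℝ, W))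
    {N : ℕ} (s : Fin N → ℝ) : Set (Fin N → ℝ × ℝ) :=
  {w | ∃ Z ∈ Y, SolvesOn F u a b Z ∧ ∃ c d : ℝ,
    ∀ i, s i + c + d * (w i).2 ∈ Icc a b ∧ (w i).1 = col (Z (s i + c + d * (w i).2))}

/-- The set is the image of parameters `(Z a, c, d, rows)` under a composite `g₂ ∘ E ∘ g₁` that does
not raise Hausdorff dimension, and `finrank W + 2 + N < 2 * N`. The factorization separates the maps
`g₁`, `g₂`, which are C¹ everywhere, from `E`, which is known to be Lipschitz only on the set `D` of
admissible data. -/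
theorem dense_compl_matchedSamples {F : W × Input → W} (hF : ContDiff ℝ 1 F) {col : W → ℝ}
    (hcol : ContDiff ℝ 1 col) (u : SmoothInput) (a b R : ℝ) (M : NNReal)
    {N : ℕ} (hN : Module.finrank ℝ W + 2 < N) (s : Fin N → ℝ) :
    Dense (matchedSamples F col u a b (lipCurves (Metric.closedBall 0 R) M) s)ᶜ := by
  rcases lt_or_ge b a with hab | hab
  · have : matchedSamples F col u a b (lipCurves (Metric.closedBall 0 R) M) s = ∅ := by
      ext w
      simp only [matchedSamples, mem_ofPred_eq, mem_empty_iff_false, iff_false]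
      rintro ⟨Z, -, -, c, d, h⟩
      have := (h ⟨0, by omega⟩).1
      exact absurd (this.1.trans this.2) (not_le.mpr hab)
    rw [this, compl_empty]
    exact dense_univ
  obtain ⟨K, hK⟩ := exists_lipschitzOnWith_closedBall hF u a b R
  let S : Set C(ℝ, W) := {Z | Z ∈ lipCurves (Metric.closedBall 0 R) M ∧ SolvesOn F u a b Z}
  let L : NNReal := ⟨Real.exp (K * (b - a)), (Real.exp_pos _).le⟩
  have hd : ∀ Y ∈ S, ∀ Z ∈ S, ∀ t ∈ Icc a b, dist (Y t) (Z t) ≤ L * dist (Y a) (Z a) := by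
    intro Y hY Z hZ t ht
    refine (hY.2.dist_le hK hZ.2 (fun t _ => hY.1.2 t) (fun t _ => hZ.1.2 t) ht).trans ?_
    rw [mul_comm]
    refine mul_le_mul_of_nonneg_right (Real.exp_le_exp.mpr ?_) dist_nonneg
    exact mul_le_mul_of_nonneg_left (by linarith [ht.2]) K.2
  -- One solution is chosen per initial value. By `hd` the choice does not matter on `[a, b]`; the
  -- constant curve is a default for values from which no solution in `S` starts.
  have hsol : ∀ z : W, ∃ Y : C(ℝ, W), (∃ Z ∈ S, Z a = z) → Y ∈ S ∧ Y a = z := by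
    intro z
    by_cases h : ∃ Z ∈ S, Z a = z
    · obtain ⟨Z, hZ, hz⟩ := h
      exact ⟨Z, fun _ => ⟨hZ, hz⟩⟩
    · exact ⟨ContinuousMap.const _ 0, fun h' => absurd h' h⟩
  choose sol hsol using hsol
  let g₁ : W × ℝ × ℝ × (Fin N → ℝ) → W × (Fin N → ℝ) × (Fin N → ℝ) :=
    fun p => (p.1, fun i => s i + p.2.1 + p.2.2.1 * p.2.2.2 i, p.2.2.2)
  let D : Set (W × (Fin N → ℝ) × (Fin N → ℝ)) :=
    range g₁ ∩ {p | (∃ Z ∈ S, Z a = p.1) ∧ ∀ i, p.2.1 i ∈ Icc a b}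
  let E : W × (Fin N → ℝ) × (Fin N → ℝ) → (Fin N → W) × (Fin N → ℝ) :=
    fun p => (fun i => sol p.1 (p.2.1 i), p.2.2)
  let g₂ : (Fin N → W) × (Fin N → ℝ) → Fin N → ℝ × ℝ := fun p i => (col (p.1 i), p.2 i)
  have hg₁ : ContDiff ℝ 1 g₁ := by
    refine contDiff_fst.prodMk (ContDiff.prodMk ?_ (by fun_prop))
    exact contDiff_pi.mpr fun i => by fun_prop
  have hg₂ : ContDiff ℝ 1 g₂ := by
    refine contDiff_pi.mpr fun i => ContDiff.prodMk (hcol.comp ?_) (by fun_prop)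
    fun_prop
  have hD : dimH D ≤ (Module.finrank ℝ W + 2 + N : ℕ) := by
    refine (dimH_mono inter_subset_left).trans (hg₁.dimH_range_le.trans ?_)
    simp only [Module.finrank_prod, Module.finrank_self, Module.finrank_fintype_fun_eq_card,
      Fintype.card_fin]
    norm_cast
    omega
  have hE : LipschitzOnWith (L + M + 1) E D := by
    refine LipschitzOnWith.of_dist_le_mul fun p hp q hq => ?_
    have hp' := hsol p.1 hp.2.1
    have hq' := hsol q.1 hq.2.1
    have hpq : 0 ≤ dist p q := dist_nonneg
    rw [Prod.dist_eq]
    refine max_le ?_ ?_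
    · refine (dist_pi_le_iff (by positivity)).mpr fun i => ?_
      calc dist (sol p.1 (p.2.1 i)) (sol q.1 (q.2.1 i))
          ≤ dist (sol p.1 (p.2.1 i)) (sol q.1 (p.2.1 i))
            + dist (sol q.1 (p.2.1 i)) (sol q.1 (q.2.1 i)) := dist_triangle _ _ _
        _ ≤ L * dist p q + M * dist p q := by
          refine add_le_add ((hd _ hp'.1 _ hq'.1 _ (hp.2.2 i)).trans ?_)
            ((hq'.1.1.1.dist_le_mul _ _).trans ?_)
          · rw [hp'.2, hq'.2]
            exact mul_le_mul_of_nonneg_left (le_max_left _ _) L.2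
          · refine mul_le_mul_of_nonneg_left ?_ M.2
            exact (dist_le_pi_dist p.2.1 q.2.1 i).trans ((le_max_left _ _).trans (le_max_right _ _))
        _ ≤ _ := by push_cast; nlinarith
    · refine ((le_max_right _ _).trans (le_max_right _ _) : dist p.2.2 q.2.2 ≤ dist p q).trans ?_
      have := L.2
      have := M.2
      push_cast
      nlinarith [mul_nonneg L.2 hpq, mul_nonneg M.2 hpq]
  have hsub : matchedSamples F col u a b (lipCurves (Metric.closedBall 0 R) M) s ⊆
      g₂ '' (E '' D) := by
    rintro w ⟨Z, hZ, hZs, c, d, h⟩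
    have hZS : Z ∈ S := ⟨hZ, hZs⟩
    have hz := hsol (Z a) ⟨Z, hZS, rfl⟩
    refine ⟨_, ⟨g₁ (Z a, c, d, fun i => (w i).2), ⟨mem_range_self _, ⟨Z, hZS, rfl⟩,
      fun i => (h i).1⟩, rfl⟩, ?_⟩
    funext i
    refine Prod.ext ?_ rfl
    have : dist (sol (Z a) (s i + c + d * (w i).2)) (Z (s i + c + d * (w i).2)) ≤ 0 := by
      refine (hd _ hz.1 _ hZS _ (h i).1).trans ?_
      rw [hz.2, dist_self, mul_zero]
    exact (congrArg col (dist_le_zero.mp this)).trans (h i).2.symm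
  refine dense_compl_of_dimH_lt_finrank ?_
  calc dimH _ ≤ dimH (g₂ '' (E '' D)) := dimH_mono hsub
    _ ≤ dimH (E '' D) := hg₂.contDiffOn.dimH_image_le convex_univ (subset_univ _)
    _ ≤ dimH D := hE.dimH_image_le
    _ ≤ _ := hD
    _ < _ := by
      simp only [Module.finrank_pi_fintype, Module.finrank_prod, Module.finrank_self,
        Finset.sum_const, Finset.card_univ, Fintype.card_fin, smul_eq_mul]
      norm_cast
      omega

end Dimension

/-! ### The exceptional sets of inputs are closed with empty interior. -/

section NowhereDense

variable {W : Type*} [NormedAddCommGroup W] [NormedSpace ℝ W] [FiniteDimensional ℝ W]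

/-- The inputs under which the solution through `w₀` at time `s₀` shows, on `[p, q]`, the same image
as another solution shows on `[p', q']` at the times shifted in proportion to the row. -/
def matchedInputs (F : W × Input → W) (col row : W → ℝ) (s₀ : ℝ) (w₀ : W) (C C' : Set W)
    (M : NNReal) (α β p q p' q' : ℝ) : Set SmoothInput :=
  {u | ∃ Y ∈ lipCurves C M, ∃ Z ∈ lipCurves C' M, ∃ c ∈ Icc (-M : ℝ) M, ∃ d ∈ Icc (-M : ℝ) M,
    Y s₀ = w₀ ∧ SolvesOn F u α β Y ∧ SolvesOn F u p' q' Z ∧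
    ∀ s ∈ Icc p q, s + c + d * row (Y s) ∈ Icc p' q' ∧
      col (Y s) = col (Z (s + c + d * row (Y s)))}

/-- The inputs under which the solution through `w₀` at time `s₀` has a constant row on `[p, q]`. -/
def constantRowInputs (F : W × Input → W) (row : W → ℝ) (s₀ : ℝ) (w₀ : W) (C : Set W)
    (M : NNReal) (α β p q : ℝ) : Set SmoothInput :=
  {u | ∃ Y ∈ lipCurves C M, Y s₀ = w₀ ∧ SolvesOn F u α β Y ∧
    ∀ s ∈ Icc p q, row (Y s) = row (Y p)}

variable {F : W × Input → W} {col row : W → ℝ}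

/-- All conditions are closed in `(u, Y, Z, c, d)`, and the bounds by `C`, `C'` and `M` confine `(Y,
Z, c, d)` to a compact set. -/
theorem isClosed_matchedInputs (hF : Continuous F) (hcol : Continuous col) (hrow : Continuous row)
    (s₀ : ℝ) (w₀ : W) {C C' : Set W} (hC : IsCompact C) (hC' : IsCompact C') (M : NNReal)
    (α β p q p' q' : ℝ) :
    IsClosed (matchedInputs F col row s₀ w₀ C C' M α β p q p' q') := by
  have : CompleteSpace W := FiniteDimensional.complete ℝ W
  let X := SmoothInput × C(ℝ, W) × C(ℝ, W) × ℝ × ℝ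
  let t : ℝ → X → ℝ := fun s x => s + x.2.2.2.1 + x.2.2.2.2 * row (x.2.1 s)
  have hY : ∀ s : ℝ, Continuous fun x : X => x.2.1 s := fun s =>
    (continuous_fst.comp continuous_snd).eval continuous_const
  have ht : ∀ s, Continuous (t s) := fun s => by
    have := hrow.comp (hY s)
    simp only [t]
    fun_prop
  have hZ : ∀ s : ℝ, Continuous fun x : X => x.2.2.1 (t s x) := fun s =>
    (continuous_fst.comp (continuous_snd.comp continuous_snd)).eval (ht s)
  have hR : IsClosed {x : X | x.2.1 s₀ = w₀ ∧ SolvesOn F x.1 α β x.2.1 ∧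
      SolvesOn F x.1 p' q' x.2.2.1 ∧
      ∀ s ∈ Icc p q, t s x ∈ Icc p' q' ∧ col (x.2.1 s) = col (x.2.2.1 (t s x))} := by
    have h : IsClosed {x : X | ∀ s ∈ Icc p q,
        t s x ∈ Icc p' q' ∧ col (x.2.1 s) = col (x.2.2.1 (t s x))} := by
      simp only [ofPred_forall]
      refine isClosed_iInter fun s => isClosed_iInter fun _ => IsClosed.inter ?_ ?_
      · exact isClosed_Icc.preimage (ht s)
      · exact isClosed_eq (hcol.comp (hY s)) (hcol.comp (hZ s))
    refine (isClosed_eq (hY s₀) continuous_const).inter (IsClosed.inter ?_ (IsClosed.inter ?_ h))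
    · exact (isClosed_solvesOn hF α β).preimage
        (f := fun x : X => (x.1, x.2.1)) (by fun_prop)
    · exact (isClosed_solvesOn hF p' q').preimage
        (f := fun x : X => (x.1, x.2.2.1)) (by fun_prop)
  have hK := (isCompact_lipCurves hC M).prod ((isCompact_lipCurves hC' M).prod
    ((isCompact_Icc (a := (-M : ℝ)) (b := M)).prod (isCompact_Icc (a := (-M : ℝ)) (b := M))))
  convert isClosed_exists_of_isCompact hK hR using 1
  ext u
  constructor
  · rintro ⟨Y, hY, Z, hZ, c, hc, d, hd, h⟩
    exact ⟨(Y, Z, c, d), ⟨hY, hZ, hc, hd⟩, h⟩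
  · rintro ⟨⟨Y, Z, c, d⟩, ⟨hY, hZ, hc, hd⟩, h⟩
    exact ⟨Y, hY, Z, hZ, c, hc, d, hd, h⟩

theorem isClosed_constantRowInputs (hF : Continuous F) (hrow : Continuous row)
    (s₀ : ℝ) (w₀ : W) {C : Set W} (hC : IsCompact C) (M : NNReal) (α β p q : ℝ) :
    IsClosed (constantRowInputs F row s₀ w₀ C M α β p q) := by
  have : CompleteSpace W := FiniteDimensional.complete ℝ W
  let X := SmoothInput × C(ℝ, W)
  have hY : ∀ s : ℝ, Continuous fun x : X => x.2 s := fun s =>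
    continuous_snd.eval continuous_const
  have hR : IsClosed {x : X | x.2 s₀ = w₀ ∧ SolvesOn F x.1 α β x.2 ∧
      ∀ s ∈ Icc p q, row (x.2 s) = row (x.2 p)} := by
    have h : IsClosed {x : X | ∀ s ∈ Icc p q, row (x.2 s) = row (x.2 p)} := by
      simp only [ofPred_forall]
      exact isClosed_iInter fun s => isClosed_iInter fun _ =>
        isClosed_eq (hrow.comp (hY s)) (hrow.comp (hY p))
    exact (isClosed_eq (hY s₀) continuous_const).inter ((isClosed_solvesOn hF α β).inter h)
  exact isClosed_exists_of_isCompact (isCompact_lipCurves hC M) hR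

/-- Solutions under `u` that stay in `C` on `[α, β]` can be perturbed on `[p, q]`, by a small change
of the input there, such that finitely many image samples avoid a set with dense complement. -/
def SamplesPerturbable (F : W × Input → W) (col row : W → ℝ) (C : Set W) (α β p q : ℝ) : Prop :=
  ∀ (u : SmoothInput) (Y : ℝ → W), SolvesOn F u α β Y → (∀ s ∈ Icc α β, Y s ∈ C) →
    ∀ (N : ℕ) (s : Fin N → ℝ), Function.Injective s → (∀ i, s i ∈ Ioo p q) →
    ∀ E : Set (Fin N → ℝ × ℝ), Dense Eᶜ → ∀ U ∈ 𝓝 u, ∃ w ∈ U, (∀ t ∉ Icc p q, w.val t = u.val t) ∧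
    ∃ Z : ℝ → W, SolvesOn F w α β Z ∧ (∀ t ∉ Icc p q, Z t = Y t) ∧
      (fun i => (col (Z (s i)), row (Z (s i)))) ∉ E

theorem exists_injective_mem_Ioo {p q : ℝ} (hpq : p < q) (N : ℕ) :
    ∃ s : Fin N → ℝ, Function.Injective s ∧ ∀ i, s i ∈ Ioo p q := by
  have : Infinite (Ioo p q) := (Ioo_infinite hpq).to_subtype
  let e : Fin N ↪ Ioo p q := Fin.valEmbedding.trans (Infinite.natEmbedding _)
  exact ⟨fun i => e i, Subtype.val_injective.comp e.injective, fun i => (e i).2⟩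

/-- The perturbation lives on `[p, q]`, so the solutions on `[p', q']` are still those of `u`. The
set the samples must avoid is therefore fixed before the perturbation is chosen. -/
theorem interior_matchedInputs (hF : ContDiff ℝ 1 F) (hcol : ContDiff ℝ 1 col)
    {s₀ : ℝ} {w₀ : W} {C : Set W} {R : ℝ} {M : NNReal} {α β p q p' q' : ℝ}
    (hP : SamplesPerturbable F col row C α β p q)
    (hs₀ : s₀ ∈ Ioo α β) (hp : α < p) (hpq : p < q) (hq : q < β) (hs₀' : s₀ ∉ Icc p q)
    (hdisj : Disjoint (Icc p q) (Icc p' q')) :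
    interior (matchedInputs F col row s₀ w₀ C (Metric.closedBall 0 R) M α β p q p' q') = ∅ := by
  rw [eq_empty_iff_forall_notMem]
  intro u hu
  obtain ⟨Y, hY, -, -, -, -, -, -, hY₀, hYs, -⟩ := interior_subset hu
  -- The least number of samples for which the dimension count is strict.
  let N := Module.finrank ℝ W + 3
  obtain ⟨s, hs, hsm⟩ := exists_injective_mem_Ioo hpq N
  obtain ⟨w, hw, hwu, Z, hZs, hZY, hZE⟩ := hP u Y hYs (fun t _ => hY.2 t) N s hs hsm _
    (dense_compl_matchedSamples hF hcol u p' q' R M (by omega) s) _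
    (mem_interior_iff_mem_nhds.mp hu)
  obtain ⟨Y₁, -, Z₁, hZ₁, c, -, d, -, hY₁₀, hY₁s, hZ₁s, h⟩ := hw
  -- The perturbed curve still passes through `w₀` at `s₀`, because `s₀` lies outside `[p, q]`;
  -- uniqueness identifies it with the witness for `w`.
  have heq : EqOn Y₁ Z (Icc α β) := hY₁s.eqOn hF hZs hs₀ (by rw [hY₁₀, hZY _ hs₀', hY₀])
  have hmem : ∀ i, s i ∈ Icc α β := fun i =>
    ⟨(hp.trans (hsm i).1).le, ((hsm i).2.trans hq).le⟩
  refine hZE ⟨Z₁, hZ₁, hZ₁s.congr_input fun t ht => (hwu t ?_).symm, c, d, fun i => ?_⟩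
  · exact fun h' => disjoint_left.mp hdisj h' ht
  · have := h (s i) (Ioo_subset_Icc_self (hsm i))
    rwa [heq (hmem i)] at this

/-- Two samples suffice: pairs with equal rows form a set with dense complement. -/
theorem interior_constantRowInputs (hF : ContDiff ℝ 1 F)
    {s₀ : ℝ} {w₀ : W} {C : Set W} {M : NNReal} {α β p q : ℝ}
    (hP : SamplesPerturbable F col row C α β p q)
    (hs₀ : s₀ ∈ Ioo α β) (hp : α < p) (hpq : p < q) (hq : q < β) (hs₀' : s₀ ∉ Icc p q) :
    interior (constantRowInputs F row s₀ w₀ C M α β p q) = ∅ := by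
  rw [eq_empty_iff_forall_notMem]
  intro u hu
  obtain ⟨Y, hY, hY₀, hYs, -⟩ := interior_subset hu
  obtain ⟨s, hs, hsm⟩ := exists_injective_mem_Ioo hpq 2
  have hE : Dense {w : Fin 2 → ℝ × ℝ | (w 0).2 = (w 1).2}ᶜ := by
    rw [← interior_eq_empty_iff_dense_compl, eq_empty_iff_forall_notMem]
    intro w hw
    have hc : Continuous fun ε : ℝ => Function.update w 0 ((w 0).1, (w 0).2 + ε) := by fun_prop
    have h0 : Function.update w 0 ((w 0).1, (w 0).2 + 0) = w := by simp
    have hev : ∀ᶠ ε : ℝ in 𝓝 0, Function.update w 0 ((w 0).1, (w 0).2 + ε) ∈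
        {w : Fin 2 → ℝ × ℝ | (w 0).2 = (w 1).2} := by
      refine hc.continuousAt.eventually_mem ?_
      rw [h0]
      exact mem_interior_iff_mem_nhds.mp hw
    have h1 := interior_subset hw
    obtain ⟨ε, hε, hε0⟩ := ((hev.filter_mono nhdsWithin_le_nhds).and
      (self_mem_nhdsWithin (s := {(0 : ℝ)}ᶜ))).exists
    simp only [mem_ofPred_eq, Function.update_self, ne_eq, one_ne_zero, not_false_eq_true,
      Function.update_of_ne] at hε h1
    exact hε0 (by simp only [mem_singleton_iff]; linarith)
  obtain ⟨w, hw, hwu, Z, hZs, hZY, hZE⟩ := hP u Y hYs (fun t _ => hY.2 t) 2 s hs hsm _ hE _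
    (mem_interior_iff_mem_nhds.mp hu)
  obtain ⟨Y₁, -, hY₁₀, hY₁s, h⟩ := hw
  have heq : EqOn Y₁ Z (Icc α β) := hY₁s.eqOn hF hZs hs₀ (by rw [hY₁₀, hZY _ hs₀', hY₀])
  have hmem : ∀ i, s i ∈ Icc α β := fun i =>
    ⟨(hp.trans (hsm i).1).le, ((hsm i).2.trans hq).le⟩
  refine hZE ?_
  simp only [mem_ofPred_eq]
  rw [← heq (hmem 0), ← heq (hmem 1), h _ (Ioo_subset_Icc_self (hsm 0)),
    h _ (Ioo_subset_Icc_self (hsm 1))]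

end NowhereDense

/-! ### The augmented system and its smoothness. -/

/-- The constant parameters as a normed space. -/
abbrev Params :=
  V3 × V3 × (Fin 3 → Fin 3 → ℝ) × (Fin 3 → Fin 3 → ℝ) × (Fin 6 → ℝ) ×
    V3 × (Fin 4 → ℝ) × (Fin 8 → ℝ)

/-- The constant parameters, with matrices in place of arrays. -/
def Params.toCalib (c : Params) : Calib :=
  (c.1, c.2.1, Matrix.of c.2.2.1, Matrix.of c.2.2.2.1, c.2.2.2.2)

/-- The constant parameters, with arrays in place of matrices. -/
def Calib.toParams (θ : Calib) : Params :=
  (θ.1, θ.2.1, Matrix.of.symm θ.2.2.1, Matrix.of.symm θ.2.2.2.1, θ.2.2.2.2)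

@[simp] theorem Calib.toCalib_toParams (θ : Calib) : θ.toParams.toCalib = θ := rfl

/-- The navigation state together with the constant parameters. -/
abbrev AugState := NavState × Params

/-- The dynamics with the constant parameters as part of the state. -/
def augDyn (p : AugState × Input) : AugState := (dyn p.1.2.toCalib p.1.1 p.2, 0)

/-- Image column as a function of the augmented state. -/
def augCol (w : AugState) : ℝ := imgCol w.2.toCalib w.1

/-- Image row as a function of the augmented state. -/
def augRow (w : AugState) : ℝ := imgRow w.2.toCalib w.1

theorem contDiff_augCol : ContDiff ℝ ∞ augCol := by
  unfold augCol imgCol Params.toCalib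
  simp only
  fun_prop

theorem contDiff_augRow : ContDiff ℝ ∞ augRow := by
  unfold augRow imgRow Params.toCalib
  simp only
  fun_prop

theorem contDiffOn_mulVec {E : Type*} [NormedAddCommGroup E] [NormedSpace ℝ E]
    {A : E → Matrix (Fin 3) (Fin 3) ℝ} {f : E → V3} {s : Set E}
    (hA : ∀ i j, ContDiffOn ℝ ∞ (fun x => A x i j) s) (hf : ContDiffOn ℝ ∞ f s) :
    ContDiffOn ℝ ∞ (fun x => A x *ᵥ f x) s := by
  rw [contDiffOn_pi] at hf ⊢
  intro i
  simp only [mulVec, dotProduct]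
  exact ContDiffOn.sum fun j _ => (hA i j).mul (hf j)

theorem contDiff_angRate :
    ContDiff ℝ ∞ fun p : AugState × Input => angRate p.1.2.toCalib p.2 := by
  have hM : ∀ i j, ContDiff ℝ ∞ fun p : AugState × Input => p.1.2.toCalib.Mg i j := fun i j => by
    change ContDiff ℝ ∞ fun p : AugState × Input => p.1.2.2.2.1 i j
    fun_prop
  have hT : ∀ i j, ContDiff ℝ ∞ fun p : AugState × Input => p.1.2.toCalib.Ts i j := fun i j => by
    change ContDiff ℝ ∞ fun p : AugState × Input => p.1.2.2.2.2.1 i j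
    fun_prop
  have hg : ContDiff ℝ ∞ fun p : AugState × Input => p.2.2 - p.1.2.toCalib.bg := by
    change ContDiff ℝ ∞ fun p : AugState × Input => p.2.2 - p.1.2.1
    fun_prop
  have ha : ContDiff ℝ ∞ fun p : AugState × Input => p.2.1 - p.1.2.toCalib.ba := by
    change ContDiff ℝ ∞ fun p : AugState × Input => p.2.1 - p.1.2.2.1
    fun_prop
  rw [← contDiffOn_univ] at hg ha ⊢
  exact (contDiffOn_mulVec (fun i j => (hM i j).contDiffOn) hg).sub
    (contDiffOn_mulVec (fun i j => (hM i j).contDiffOn)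
      (contDiffOn_mulVec (fun i j => (hT i j).contDiffOn) ha))

theorem contDiff_accel :
    ContDiff ℝ ∞ fun p : AugState × Input => accel p.1.2.toCalib p.2 := by
  refine contDiff_pi.mpr fun i => ?_
  fin_cases i <;>
  · simp [accel, Params.toCalib, mulVec, dotProduct, Fin.sum_univ_three, Calib.Ma]
    fun_prop

theorem contDiffOn_crossProduct {E : Type*} [NormedAddCommGroup E] [NormedSpace ℝ E]
    {f g : E → V3} {s : Set E} (hf : ContDiffOn ℝ ∞ f s) (hg : ContDiffOn ℝ ∞ g s) :
    ContDiffOn ℝ ∞ (fun x => f x ⨯₃ g x) s := by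
  rw [contDiffOn_pi] at hf hg ⊢
  intro i
  have := hf 0
  have := hf 1
  have := hf 2
  have := hg 0
  have := hg 1
  have := hg 2
  fin_cases i <;>
  · simp only [cross_apply]
    simp
    fun_prop

theorem contDiff_RCB : ∀ i j, ContDiff ℝ ∞ fun p : AugState × Input => p.1.2.toCalib.RCB i j := by
  intro i j
  fin_cases i <;> fin_cases j <;>
  · simp [Calib.RCB, Params.toCalib]
    fun_prop

theorem contDiff_landmarkRate :
    ContDiff ℝ ∞ fun p : AugState × Input => landmarkRate p.1.2.toCalib p.1.1 p.2 := by
  have hR := contDiff_RCB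
  have h1 : ContDiff ℝ ∞ fun p : AugState × Input =>
      p.1.2.toCalib.RCB *ᵥ angRate p.1.2.toCalib p.2 :=
    contDiffOn_univ.mp (contDiffOn_mulVec (fun i j => (hR i j).contDiffOn)
      contDiff_angRate.contDiffOn)
  have h2 : ContDiff ℝ ∞ fun p : AugState × Input => p.1.2.toCalib.RCB *ᵥ p.1.1.v :=
    contDiffOn_univ.mp (contDiffOn_mulVec (fun i j => (hR i j).contDiffOn)
      (contDiffOn_univ.mpr (by fun_prop)))
  have h3 : ContDiff ℝ ∞ fun p : AugState × Input =>
      p.1.1.ρ • p.1.2.toCalib.pCB - ![p.1.1.γ 0, p.1.1.γ 1, 1] := by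
    refine contDiff_pi.mpr fun i => ?_
    fin_cases i <;> simp [Params.toCalib] <;> fun_prop
  have h4 := contDiffOn_crossProduct h1.contDiffOn h3.contDiffOn (s := univ)
  rw [contDiffOn_univ] at h4
  have h5 : ContDiff ℝ ∞ fun p : AugState × Input => p.1.1.ρ := by fun_prop
  unfold landmarkRate
  exact h4.sub (h5.smul h2)

theorem contDiff_augDyn : ContDiff ℝ ∞ augDyn := by
  have hL := contDiff_pi.mp contDiff_landmarkRate
  have hw := contDiff_angRate
  have ha := contDiff_accel
  have h0 := hL 0
  have h1 := hL 1
  have h2 := hL 2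
  have hv := contDiffOn_crossProduct (f := fun p : AugState × Input => p.1.1.v)
    (contDiffOn_univ.mpr (by fun_prop)) hw.contDiffOn
  have hg := contDiffOn_crossProduct (f := fun p : AugState × Input => p.1.1.g)
    (contDiffOn_univ.mpr (by fun_prop)) hw.contDiffOn
  rw [contDiffOn_univ] at hv hg
  unfold augDyn dyn
  refine ContDiff.prodMk (ContDiff.prodMk ?_ (ContDiff.prodMk ?_ (ContDiff.prodMk ?_ hg)))
    contDiff_const
  · refine contDiff_pi.mpr fun i => ?_
    fin_cases i <;> simp <;> fun_prop
  · fun_prop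
  · exact (hv.add ha).add (by fun_prop)

/-! ### The camera model is locally invertible on a dense set -/

/-- The image point as a function of the landmark direction. -/
def imgMap (θ : Calib) (a : ℝ × ℝ) : ℝ × ℝ :=
  (imgCol θ (![a.1, a.2], 0, 0, 0), imgRow θ (![a.1, a.2], 0, 0, 0))

/-- The entries of the Jacobian matrix of the camera model. -/
def imgJac (θ : Calib) (a : ℝ × ℝ) : ℝ × ℝ × ℝ × ℝ :=
  let r := a.1 ^ 2 + a.2 ^ 2
  let κ := 1 + θ.intr 4 * r + θ.intr 5 * r ^ 2
  let κ' := 2 * θ.intr 4 + 4 * θ.intr 5 * r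
  (θ.intr 0 * (κ + a.1 ^ 2 * κ' + 2 * θ.intr 6 * a.2 + 6 * θ.intr 7 * a.1),
   θ.intr 0 * (a.1 * a.2 * κ' + 2 * θ.intr 6 * a.1 + 2 * θ.intr 7 * a.2),
   θ.intr 1 * (a.1 * a.2 * κ' + 2 * θ.intr 6 * a.1 + 2 * θ.intr 7 * a.2),
   θ.intr 1 * (κ + a.2 ^ 2 * κ' + 6 * θ.intr 6 * a.2 + 2 * θ.intr 7 * a.1))

/-- The determinant of the Jacobian matrix of the camera model. -/
def imgDet (θ : Calib) (a : ℝ × ℝ) : ℝ :=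
  (imgJac θ a).1 * (imgJac θ a).2.2.2 - (imgJac θ a).2.1 * (imgJac θ a).2.2.1

theorem hasStrictFDerivAt_imgMap (θ : Calib) (a : ℝ × ℝ) :
    HasStrictFDerivAt (imgMap θ)
      (((imgJac θ a).1 • ContinuousLinearMap.fst ℝ ℝ ℝ +
          (imgJac θ a).2.1 • ContinuousLinearMap.snd ℝ ℝ ℝ).prod
        ((imgJac θ a).2.2.1 • ContinuousLinearMap.fst ℝ ℝ ℝ +
          (imgJac θ a).2.2.2 • ContinuousLinearMap.snd ℝ ℝ ℝ)) a := by
  have h₁ := (hasStrictFDerivAt_fst (𝕜 := ℝ) (E := ℝ) (F := ℝ) (p := a))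
  have h₂ := (hasStrictFDerivAt_snd (𝕜 := ℝ) (E := ℝ) (F := ℝ) (p := a))
  have hr := (h₁.pow 2).add (h₂.pow 2)
  have hκ := ((hr.const_mul (θ.intr 4)).const_add 1).add ((hr.pow 2).const_mul (θ.intr 5))
  have hc := ((((h₁.mul hκ).add ((h₁.const_mul (2 * θ.intr 6)).mul h₂)).add
    ((hr.add ((h₁.pow 2).const_mul 2)).const_mul (θ.intr 7))).const_mul (θ.intr 0)).add_const
      (θ.intr 2)
  have hv := ((((h₂.mul hκ).add ((hr.add ((h₂.pow 2).const_mul 2)).const_mul (θ.intr 6))).add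
    ((h₁.const_mul (2 * θ.intr 7)).mul h₂)).const_mul (θ.intr 1)).add_const (θ.intr 3)
  refine HasStrictFDerivAt.prodMk ?_ ?_
  · convert hc using 1
    · funext x
      simp [imgCol, NavState.γ]
    · refine ContinuousLinearMap.ext fun x => ?_
      simp [imgJac]
      ring
  · convert hv using 1
    · funext x
      simp [imgRow, NavState.γ]
    · refine ContinuousLinearMap.ext fun x => ?_
      simp [imgJac]
      ring

/-- The distortion may be singular at `a`. Along the ray through `a` the Jacobian determinant is
analytic and equals `f_x * f_y ≠ 0` at the origin, so it is nonzero at points of the ray arbitrarily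
close to `a`, where the map is open. -/
theorem interior_image_imgMap_nonempty {θ : Calib} (hx : θ.intr 0 ≠ 0) (hy : θ.intr 1 ≠ 0)
    {a : ℝ × ℝ} {V : Set (ℝ × ℝ)} (hV : V ∈ 𝓝 a) : (interior (imgMap θ '' V)).Nonempty := by
  let f : ℝ → ℝ := fun t => imgDet θ (t * a.1, t * a.2)
  have hf : AnalyticOnNhd ℝ f univ := by
    intro t _
    simp only [f, imgDet, imgJac]
    fun_prop
  have hev : ∀ᶠ t in 𝓝[≠] (1 : ℝ), f t ≠ 0 := by
    rcases hf.eqOn_zero_or_eventually_ne_zero_of_preconnected isPreconnected_univ with h | h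
    · have := h (mem_univ 0)
      simp [f, imgDet, imgJac, hx, hy] at this
    · rw [Filter.Eventually, mem_codiscreteWithin] at h
      have := h 1 (mem_univ _)
      rw [disjoint_principal_right] at this
      filter_upwards [this] with t ht h0
      exact ht ⟨mem_univ _, fun h' => h' h0⟩
  have hcont : Tendsto (fun t : ℝ => (t * a.1, t * a.2)) (𝓝 1) (𝓝 a) := by
    have : Continuous fun t : ℝ => (t * a.1, t * a.2) := by fun_prop
    simpa using this.tendsto 1
  obtain ⟨t, ht0, htV⟩ := (hev.and ((hcont.eventually
    (eventually_mem_nhds_iff.mpr hV)).filter_mono nhdsWithin_le_nhds)).exists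
  set a' : ℝ × ℝ := (t * a.1, t * a.2)
  have hd : imgDet θ a' ≠ 0 := ht0
  have hs := (hasStrictFDerivAt_imgMap θ a').map_nhds_eq_of_surj (by
    rw [LinearMap.range_eq_top]
    intro y
    refine ⟨(((imgJac θ a').2.2.2 * y.1 - (imgJac θ a').2.1 * y.2) / imgDet θ a',
      ((imgJac θ a').1 * y.2 - (imgJac θ a').2.2.1 * y.1) / imgDet θ a'), ?_⟩
    ext
    · simp
      field_simp
      simp only [imgDet]
      ring
    · simp
      field_simp
      simp only [imgDet]
      ring)
  refine ⟨imgMap θ a', mem_interior_iff_mem_nhds.mpr ?_⟩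
  rw [← hs]
  exact image_mem_map htV

/-! ### Linear perturbations of inputs -/

/-- The input `u + ∑ i, c i • d i`. -/
def SmoothInput.addSum {ι : Type*} [Fintype ι] (u : SmoothInput) (d : ι → SmoothInput)
    (c : ι → ℝ) : SmoothInput where
  val s := u.val s + ∑ i, c i • (d i).val s
  smooth := u.smooth.add (ContDiff.sum fun i _ => (d i).smooth.const_smul (c i))

theorem SmoothInput.continuous_addSum {ι : Type*} [Fintype ι] (u : SmoothInput)
    (d : ι → SmoothInput) : Continuous (u.addSum d) := by
  have hk : ∀ c k, (u.addSum d c).deriv k = u.deriv k + ∑ i, c i • (d i).deriv k := by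
    intro c k
    ext1 s
    have hs : ∀ v : SmoothInput, ContDiffAt ℝ k v.val s := fun v =>
      (v.smooth.of_le (by exact_mod_cast le_top)).contDiffAt
    have hsum : ∀ S : Finset ι, iteratedDeriv k (fun s => ∑ i ∈ S, c i • (d i).val s) s =
        ∑ i ∈ S, c i • iteratedDeriv k (d i).val s := by
      intro S
      induction S using Finset.cons_induction with
      | empty => simp [iteratedDeriv_fun_const_zero]
      | cons i S hi ih =>
        simp only [Finset.sum_cons]
        rw [iteratedDeriv_fun_add ((hs _).const_smul _)
          (ContDiffAt.sum fun i _ => (hs _).const_smul _), ih,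
          iteratedDeriv_fun_const_smul_field]
    simp only [SmoothInput.deriv, SmoothInput.addSum, ContinuousMap.add_apply,
      ContinuousMap.coe_sum, Finset.sum_apply, ContinuousMap.smul_apply, ContinuousMap.coe_mk]
    rw [iteratedDeriv_fun_add (hs u) (ContDiffAt.sum fun i _ => (hs _).const_smul _), hsum]
  refine continuous_induced_rng.mpr (continuous_pi fun k => ?_)
  simp only [Function.comp_apply, hk]
  fun_prop

/-- Bootstrapping: if `x` is Cⁿ, so is the right-hand side, hence `x` is Cⁿ⁺¹. -/
theorem contDiffOn_of_hasDerivAt {E : Type*} [NormedAddCommGroup E] [NormedSpace ℝ E]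
    {f : E × Input → E} (hf : ContDiff ℝ ∞ f) (u : SmoothInput) {x : ℝ → E} {O : Set ℝ}
    (hO : IsOpen O) (hx : ∀ s ∈ O, HasDerivAt x (f (x s, u.val s)) s) : ContDiffOn ℝ ∞ x O := by
  have hd : DifferentiableOn ℝ x O := fun s hs =>
    (hx s hs).differentiableAt.differentiableWithinAt
  refine contDiffOn_infty.mpr fun n => ?_
  induction n with
  | zero => simpa using hd.continuousOn
  | succ n ih =>
    push_cast
    refine (contDiffOn_succ_iff_deriv_of_isOpen hO).mpr ⟨hd, by simp, ?_⟩
    have h : ContDiffOn ℝ n (fun s => f (x s, u.val s)) O :=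
      (hf.of_le (by exact_mod_cast le_top)).comp_contDiffOn
        (ih.prodMk (u.smooth.of_le (by exact_mod_cast le_top)).contDiffOn)
    exact h.congr fun s hs => (hx s hs).deriv

theorem hasDerivAt_fst_of_prod {E F : Type*} [NormedAddCommGroup E] [NormedSpace ℝ E]
    [NormedAddCommGroup F] [NormedSpace ℝ F] {f : ℝ → E × F} {f' : E × F} {s : ℝ}
    (h : HasDerivAt f f' s) : HasDerivAt (fun s => (f s).1) f'.1 s :=
  (ContinuousLinearMap.fst ℝ E F).hasFDerivAt.comp_hasDerivAt s h

theorem hasDerivAt_snd_of_prod {E F : Type*} [NormedAddCommGroup E] [NormedSpace ℝ E]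
    [NormedAddCommGroup F] [NormedSpace ℝ F] {f : ℝ → E × F} {f' : E × F} {s : ℝ}
    (h : HasDerivAt f f' s) : HasDerivAt (fun s => (f s).2) f'.2 s :=
  (ContinuousLinearMap.snd ℝ E F).hasFDerivAt.comp_hasDerivAt s h

/-! ### Variations of the landmark direction -/

/-- A variation of the direction `γ`, as a vector of `ℝ³`. -/
def hat (η : Fin 2 → ℝ) : V3 := ![η 0, η 1, 0]

theorem hat_add (η ζ : Fin 2 → ℝ) : hat (η + ζ) = hat η + hat ζ := by
  simp [hat]

theorem hat_smul (c : ℝ) (η : Fin 2 → ℝ) : hat (c • η) = c • hat η := by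
  simp [hat]

/-- The decrease of the landmark rate caused by variations of the direction and the velocity. -/
def varRate (θ : Calib) (x : NavState) (u : Input) (η : Fin 2 → ℝ) (w : V3) : V3 :=
  (θ.RCB *ᵥ angRate θ u) ⨯₃ hat η + x.ρ • (θ.RCB *ᵥ w)

theorem varRate_add (θ : Calib) (x : NavState) (u : Input) (η ζ : Fin 2 → ℝ) (w z : V3) :
    varRate θ x u (η + ζ) (w + z) = varRate θ x u η w + varRate θ x u ζ z := by
  simp only [varRate, hat_add, map_add, mulVec_add, smul_add]
  abel

theorem varRate_smul (θ : Calib) (x : NavState) (u : Input) (c : ℝ) (η : Fin 2 → ℝ) (w : V3) :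
    varRate θ x u (c • η) (c • w) = c • varRate θ x u η w := by
  simp only [varRate, hat_smul, map_smul, mulVec_smul, smul_add, smul_comm c]

/-- Variations `η` of the direction, `w` of the velocity and `d` of the input that leave the depth,
the gravity and the calibrated angular rate unchanged and turn solutions into solutions. -/
structure IsVariation (θ : Calib) (u : ℝ → Input) (x : ℝ → NavState) (O : Set ℝ)
    (η : ℝ → Fin 2 → ℝ) (w : ℝ → V3) (d : ℝ → Input) : Prop where
  direction : ∀ s ∈ O, ∀ k : Fin 2, HasDerivAt (fun s => η s k)
    (-varRate θ (x s) (u s) (η s) (w s) k.castSucc - η s k * landmarkRate θ (x s) (u s) 2) s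
  depth : ∀ s ∈ O, varRate θ (x s) (u s) (η s) (w s) 2 = 0
  velocity : ∀ s ∈ O, HasDerivAt w (w s ⨯₃ angRate θ (u s) + θ.Ma *ᵥ (d s).1) s
  rate : ∀ s ∈ O, (d s).2 = θ.Ts *ᵥ (d s).1

namespace IsVariation

variable {θ : Calib} {u : ℝ → Input} {x : ℝ → NavState} {O : Set ℝ}
  {η ζ : ℝ → Fin 2 → ℝ} {w z : ℝ → V3} {d e : ℝ → Input}

theorem zero : IsVariation θ u x O (fun _ => 0) (fun _ => 0) (fun _ => 0) where
  direction s _ k := by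
    have := varRate_smul θ (x s) (u s) 0 0 0
    simp only [zero_smul] at this
    simpa [this] using hasDerivAt_const s (0 : ℝ)
  depth s _ := by
    have := varRate_smul θ (x s) (u s) 0 0 0
    simp only [zero_smul] at this
    simp [this]
  velocity s _ := by simpa using hasDerivAt_const s (0 : V3)
  rate s _ := by simp

theorem add (h : IsVariation θ u x O η w d) (h' : IsVariation θ u x O ζ z e) :
    IsVariation θ u x O (fun s => η s + ζ s) (fun s => w s + z s) (fun s => d s + e s) where
  direction s hs k := by
    refine ((h.direction s hs k).add (h'.direction s hs k)).congr_deriv ?_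
    simp only [varRate_add, Pi.add_apply]
    ring
  depth s hs := by simp [varRate_add, h.depth s hs, h'.depth s hs]
  velocity s hs := by
    refine ((h.velocity s hs).add (h'.velocity s hs)).congr_deriv ?_
    simp only [map_add, LinearMap.add_apply, Prod.fst_add, mulVec_add]
    abel
  rate s hs := by simp [h.rate s hs, h'.rate s hs, mulVec_add]

theorem smul (c : ℝ) (h : IsVariation θ u x O η w d) :
    IsVariation θ u x O (fun s => c • η s) (fun s => c • w s) (fun s => c • d s) where
  direction s hs k := by
    refine ((h.direction s hs k).const_mul c).congr_deriv ?_
    simp only [varRate_smul, Pi.smul_apply, smul_eq_mul]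
    ring
  depth s hs := by simp [varRate_smul, h.depth s hs]
  velocity s hs := by
    refine ((h.velocity s hs).const_smul c).congr_deriv ?_
    simp only [map_smul, LinearMap.smul_apply, Prod.smul_fst, mulVec_smul, smul_add]
  rate s hs := by simp [h.rate s hs, mulVec_smul]

theorem sum {ι : Type*} (S : Finset ι) (c : ι → ℝ) {η : ι → ℝ → Fin 2 → ℝ} {w : ι → ℝ → V3}
    {d : ι → ℝ → Input} (h : ∀ i, IsVariation θ u x O (η i) (w i) (d i)) :
    IsVariation θ u x O (fun s => ∑ i ∈ S, c i • η i s) (fun s => ∑ i ∈ S, c i • w i s)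
      (fun s => ∑ i ∈ S, c i • d i s) := by
  induction S using Finset.cons_induction with
  | empty => simpa using zero
  | cons i S hi ih =>
    simp only [Finset.sum_cons]
    exact ((h i).smul (c i)).add ih

/-- The varied solution. -/
def shift (x : NavState) (η : Fin 2 → ℝ) (w : V3) : NavState := (x.γ + η, x.ρ, x.v + w, x.g)

/-- The gyroscope variation `T_s d.1` cancels the `g`-sensitivity term of the accelerometer
variation. -/
theorem angRate_add (h : IsVariation θ u x O η w d) {s : ℝ} (hs : s ∈ O) :
    angRate θ (u s + d s) = angRate θ (u s) := by
  have h1 : (u s + d s).2 - θ.bg = ((u s).2 - θ.bg) + (d s).2 := by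
    rw [Prod.snd_add]; abel
  have h2 : (u s + d s).1 - θ.ba = ((u s).1 - θ.ba) + (d s).1 := by
    rw [Prod.fst_add]; abel
  simp only [angRate, h1, h2, h.rate s hs, mulVec_add]
  abel

theorem landmarkRate_shift (h : IsVariation θ u x O η w d) {s : ℝ} (hs : s ∈ O) :
    landmarkRate θ (shift (x s) (η s) (w s)) (u s + d s) =
      landmarkRate θ (x s) (u s) - varRate θ (x s) (u s) (η s) (w s) := by
  have h1 : ![(shift (x s) (η s) (w s)).γ 0, (shift (x s) (η s) (w s)).γ 1, 1] =
      (![(x s).γ 0, (x s).γ 1, 1] + hat (η s) : V3) := by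
    ext i
    fin_cases i <;> simp [shift, hat, NavState.γ]
  simp only [landmarkRate, h.angRate_add hs, h1, varRate]
  simp only [shift, NavState.ρ, NavState.v, mulVec_add, map_sub, map_add, smul_add]
  abel

/-- The shift is an exact solution, not a linearized one: with `ρ`, `g`, the angular rate and the
third component of the landmark rate unchanged, the remaining equations are affine in the
variations. This is why variations can be summed freely. -/
theorem hasDerivAt_shift (h : IsVariation θ u x O η w d) {s : ℝ} (hs : s ∈ O)
    (hx : HasDerivAt x (dyn θ (x s) (u s)) s) :
    HasDerivAt (fun s => shift (x s) (η s) (w s))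
      (dyn θ (shift (x s) (η s) (w s)) (u s + d s)) s := by
  have hγ : HasDerivAt (fun s => (x s).γ) (dyn θ (x s) (u s)).1 s :=
    hasDerivAt_fst_of_prod hx
  have hr : HasDerivAt (fun s => (x s).2) (dyn θ (x s) (u s)).2 s :=
    hasDerivAt_snd_of_prod hx
  have hρ : HasDerivAt (fun s => (x s).ρ) (dyn θ (x s) (u s)).2.1 s :=
    hasDerivAt_fst_of_prod hr
  have hr' : HasDerivAt (fun s => (x s).2.2) (dyn θ (x s) (u s)).2.2 s :=
    hasDerivAt_snd_of_prod hr
  have hv : HasDerivAt (fun s => (x s).v) (dyn θ (x s) (u s)).2.2.1 s :=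
    hasDerivAt_fst_of_prod hr'
  have hg : HasDerivAt (fun s => (x s).g) (dyn θ (x s) (u s)).2.2.2 s :=
    hasDerivAt_snd_of_prod hr'
  have hl := h.landmarkRate_shift hs
  have ha := h.angRate_add hs
  refine HasDerivAt.prodMk ?_ (HasDerivAt.prodMk ?_ (HasDerivAt.prodMk ?_ ?_))
  · rw [hasDerivAt_pi] at hγ ⊢
    intro k
    refine ((hγ k).add (h.direction s hs k)).congr_deriv ?_
    have hd := h.depth s hs
    unfold dyn
    rw [hl]
    fin_cases k
    · simp [shift, NavState.γ, hd]
      ring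
    · simp [shift, NavState.γ, hd]
      ring
  · refine hρ.congr_deriv ?_
    unfold dyn
    rw [hl]
    simp [h.depth s hs, shift, NavState.ρ]
  · refine (hv.add (h.velocity s hs)).congr_deriv ?_
    have hacc : accel θ (u s + d s) = accel θ (u s) + θ.Ma *ᵥ (d s).1 := by
      simp only [accel, Prod.fst_add, ← mulVec_add]
      congr 1
      abel
    simp only [dyn, ha, hacc, shift, NavState.v, NavState.g, map_add, LinearMap.add_apply]
    abel
  · refine hg.congr_deriv ?_
    simp only [dyn, ha, shift, NavState.g]

end IsVariation

/-- The product is the fourth power of the quaternion norm times the identity. -/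
theorem RCB_mul_transpose {θ : Calib} (h : θ.qCB ⬝ᵥ θ.qCB = 1) : θ.RCB * θ.RCBᵀ = 1 := by
  have h1 : θ.qCB 0 ^ 2 + θ.qCB 1 ^ 2 + θ.qCB 2 ^ 2 + θ.qCB 3 ^ 2 = 1 := by
    rw [← h, dotProduct, Fin.sum_univ_four]
    ring
  have h2 : (θ.qCB 0 ^ 2 + θ.qCB 1 ^ 2 + θ.qCB 2 ^ 2 + θ.qCB 3 ^ 2) ^ 2 = 1 := by rw [h1, one_pow]
  ext i j
  fin_cases i <;> fin_cases j <;>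
  · simp [Calib.RCB, mul_apply, Fin.sum_univ_three]
    first
    | ring1
    | linear_combination h2

/-- A smooth variation of the velocity with support in an open set can be produced by a smooth
input. -/
theorem exists_input_of_velocity {M : Matrix (Fin 3) (Fin 3) ℝ} (hM : M.det ≠ 0)
    (T : Matrix (Fin 3) (Fin 3) ℝ) {O C : Set ℝ} (hO : IsOpen O) (hC : IsClosed C) (hCO : C ⊆ O)
    {Ω w : ℝ → V3} (hΩ : ContDiffOn ℝ ∞ Ω O) (hw : ContDiffOn ℝ ∞ w O)
    (hw0 : ∀ s ∉ C, w s = 0) :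
    ∃ d : SmoothInput, (∀ s ∈ O, HasDerivAt w (w s ⨯₃ Ω s + M *ᵥ (d.val s).1) s) ∧
      (∀ s, (d.val s).2 = T *ᵥ (d.val s).1) ∧ ∀ s ∉ C, d.val s = 0 := by
  -- The velocity equation solved for the accelerometer variation.
  obtain ⟨a, hadef⟩ : ∃ a : ℝ → V3, ∀ s, a s = M⁻¹ *ᵥ (deriv w s - w s ⨯₃ Ω s) :=
    ⟨_, fun _ => rfl⟩
  have hw' : ContDiffOn ℝ ∞ (deriv w) O := hw.deriv_of_isOpen hO (by simp)
  have ha : ContDiffOn ℝ ∞ a O := by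
    rw [funext hadef]
    exact contDiffOn_mulVec (fun _ _ => contDiffOn_const)
      (hw'.sub (contDiffOn_crossProduct hw hΩ))
  have hTa : ContDiffOn ℝ ∞ (fun s => T *ᵥ a s) O :=
    contDiffOn_mulVec (fun _ _ => contDiffOn_const) ha
  have hopen : IsOpen Cᶜ := hC.isOpen_compl
  have ha0 : ∀ s ∉ C, a s = 0 := fun s hs => by
    have h1 : w =ᶠ[𝓝 s] fun _ => 0 := eventually_of_mem (hopen.mem_nhds hs) fun t ht => hw0 t ht
    simp [hadef, h1.deriv_eq, hw0 s hs]
  have hd : ContDiff ℝ ∞ fun s => (a s, T *ᵥ a s) := by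
    refine contDiff_iff_contDiffAt.mpr fun s => ?_
    -- Smoothness on the whole line: `O` and the complement of `C` are open and cover it.
    by_cases hs : s ∈ O
    · exact (ha.prodMk hTa).contDiffAt (hO.mem_nhds hs)
    · have h1 : (fun s => (a s, T *ᵥ a s)) =ᶠ[𝓝 s] fun _ => (0, 0) :=
        eventually_of_mem (hopen.mem_nhds fun h => hs (hCO h)) fun t ht => by
          simp [ha0 t ht]
      exact contDiffAt_const.congr_of_eventuallyEq h1
  refine ⟨⟨_, hd⟩, fun s hs => ?_, fun s => rfl, fun s hs => by simp [ha0 s hs]⟩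
  have h1 : HasDerivAt w (deriv w s) s :=
    ((hw.contDiffAt (hO.mem_nhds hs)).differentiableAt (by simp)).hasDerivAt
  refine h1.congr_deriv ?_
  simp only [hadef, mulVec_mulVec, Matrix.mul_nonsing_inv _ (Ne.isUnit hM), one_mulVec]
  abel

theorem contDiffOn_navState {θ : Calib} {u : SmoothInput} {x : ℝ → NavState} {O : Set ℝ}
    (hO : IsOpen O) (hx : ∀ s ∈ O, HasDerivAt x (dyn θ (x s) (u.val s)) s) :
    ContDiffOn ℝ ∞ x O := by
  have h : ContDiff ℝ ∞ fun p : NavState × Input => (augDyn ((p.1, θ.toParams), p.2)).1 :=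
    contDiff_fst.comp (contDiff_augDyn.comp (by fun_prop))
  exact contDiffOn_of_hasDerivAt (f := fun p : NavState × Input => dyn θ p.1 p.2) h u hO hx

theorem contDiffOn_angRate {u : SmoothInput} (θ : Calib) (O : Set ℝ) :
    ContDiffOn ℝ ∞ (fun s => angRate θ (u.val s)) O := by
  have h : ContDiff ℝ ∞ fun s : ℝ => (((0 : NavState), θ.toParams), u.val s) :=
    contDiff_const.prodMk u.smooth
  exact (contDiff_angRate.comp h).contDiffOn

theorem contDiffOn_landmarkRate {u : SmoothInput} {x : ℝ → NavState} {O : Set ℝ} (θ : Calib)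
    (hx : ContDiffOn ℝ ∞ x O) :
    ContDiffOn ℝ ∞ (fun s => landmarkRate θ (x s) (u.val s)) O := by
  have h : ContDiffOn ℝ ∞ (fun s : ℝ => ((x s, θ.toParams), u.val s)) O :=
    (hx.prodMk contDiffOn_const).prodMk u.smooth.contDiffOn
  have h' := contDiff_landmarkRate.comp_contDiffOn h
  simpa only [Function.comp_def, Calib.toCalib_toParams] using h'

/-- Any direction variation `ψ • e` can be prescribed. The direction and depth conditions fix all
three components of `varRate`, and `ρ ≠ 0` with an orthogonal `RCB` lets this be solved for the
velocity `w`; invertibility of `Ma` then supplies the input. -/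
theorem exists_isVariation {θ : Calib} (hq : θ.qCB ⬝ᵥ θ.qCB = 1) (hMa : θ.Ma.det ≠ 0)
    {u : SmoothInput} {x : ℝ → NavState} {O : Set ℝ} (hO : IsOpen O)
    (hx : ∀ s ∈ O, HasDerivAt x (dyn θ (x s) (u.val s)) s) (hρ : ∀ s ∈ O, (x s).ρ ≠ 0)
    {ψ : ℝ → ℝ} (hψ : ContDiff ℝ ∞ ψ) (hsupp : tsupport ψ ⊆ O) (e : Fin 2 → ℝ) :
    ∃ (w : ℝ → V3) (d : SmoothInput),
      IsVariation θ u.val x O (fun s => ψ s • e) w d.val ∧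
      ∀ s ∉ tsupport ψ, w s = 0 ∧ d.val s = 0 := by
  obtain ⟨Ω, hΩdef⟩ : ∃ Ω : ℝ → V3, ∀ s, Ω s = angRate θ (u.val s) := ⟨_, fun _ => rfl⟩
  obtain ⟨l, hldef⟩ : ∃ l : ℝ → V3, ∀ s, l s = landmarkRate θ (x s) (u.val s) :=
    ⟨_, fun _ => rfl⟩
  -- Chosen such that `varRate = -(ψ * l 2 + ψ') • hat e`: its third component vanishes, and the
  -- direction equation reduces to `η' = ψ' • e`.
  obtain ⟨m, hmdef⟩ : ∃ m : ℝ → V3, ∀ s, m s =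
    ψ s • ((θ.RCB *ᵥ Ω s) ⨯₃ hat e + l s 2 • hat e) + deriv ψ s • hat e := ⟨_, fun _ => rfl⟩
  obtain ⟨w, hwdef⟩ : ∃ w : ℝ → V3, ∀ s, w s = -((x s).ρ⁻¹ • (θ.RCBᵀ *ᵥ m s)) :=
    ⟨_, fun _ => rfl⟩
  have hxs : ContDiffOn ℝ ∞ x O := contDiffOn_navState hO hx
  have hΩ : ContDiffOn ℝ ∞ Ω O := (contDiffOn_angRate (u := u) θ O).congr fun s _ => hΩdef s
  have hl : ContDiffOn ℝ ∞ (fun s => l s 2) O :=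
    contDiffOn_pi.mp ((contDiffOn_landmarkRate (u := u) θ hxs).congr fun s _ => hldef s) 2
  have hψ' : ContDiff ℝ ∞ (deriv ψ) := (contDiff_infty_iff_deriv.mp hψ).2
  have hm : ContDiffOn ℝ ∞ m O := by
    rw [funext hmdef]
    have h1 : ContDiffOn ℝ ∞ (fun s => (θ.RCB *ᵥ Ω s) ⨯₃ hat e) O := contDiffOn_crossProduct
      (contDiffOn_mulVec (fun _ _ => contDiffOn_const) hΩ) contDiffOn_const
    exact (hψ.contDiffOn.smul (h1.add (hl.smul contDiffOn_const))).add
      (hψ'.contDiffOn.smul contDiffOn_const)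
  have hρs : ContDiffOn ℝ ∞ (fun s => (x s).ρ) O := contDiff_fst.comp_contDiffOn
    (contDiff_snd.comp_contDiffOn hxs)
  have hw : ContDiffOn ℝ ∞ w O := by
    rw [funext hwdef]
    have h1 : ContDiffOn ℝ ∞ (fun s => θ.RCBᵀ *ᵥ m s) O :=
      contDiffOn_mulVec (fun _ _ => contDiffOn_const) hm
    exact ((hρs.inv hρ).smul h1).neg
  have hw0 : ∀ s ∉ tsupport ψ, w s = 0 := fun s hs => by
    have h1 : ψ s = 0 := image_eq_zero_of_notMem_tsupport hs
    have h2 : deriv ψ s = 0 :=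
      Function.notMem_support.mp fun h => hs (support_deriv_subset h)
    simp [hwdef, hmdef, h1, h2]
  obtain ⟨d, hd1, hd2, hd0⟩ := exists_input_of_velocity hMa θ.Ts hO (isClosed_tsupport ψ) hsupp
    hΩ hw hw0
  have hRw : ∀ s ∈ O, (x s).ρ • (θ.RCB *ᵥ w s) = -m s := fun s hs => by
    rw [hwdef, mulVec_neg, mulVec_smul, mulVec_mulVec, RCB_mul_transpose hq, one_mulVec,
      smul_neg, smul_inv_smul₀ (hρ s hs)]
  have hvar : ∀ s ∈ O, varRate θ (x s) (u.val s) (ψ s • e) (w s) =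
      -((ψ s * l s 2 + deriv ψ s) • hat e) := fun s hs => by
    rw [varRate, hRw s hs, hat_smul, map_smul, hmdef, ← hΩdef]
    simp only [smul_add, add_smul, mul_smul]
    abel
  refine ⟨w, d, ⟨fun s hs k => ?_, fun s hs => ?_, fun s hs => ?_, fun s _ => hd2 s⟩,
    fun s hs => ⟨hw0 s hs, hd0 s hs⟩⟩
  · have h1 : HasDerivAt (fun s => (ψ s • e) k) (deriv ψ s * e k) s :=
      ((hψ.differentiable (by simp)).differentiableAt.hasDerivAt).mul_const (e k)
    refine h1.congr_deriv ?_
    rw [hvar s hs, ← hldef]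
    fin_cases k
    · simp [hat]
      ring
    · simp [hat]
      ring
  · rw [hvar s hs]
    simp [hat]
  · rw [← hΩdef]
    exact hd1 s hs

/-! ### Moving finitely many image samples by a change of the input. -/

theorem imgMap_γ (θ : Calib) (x : NavState) :
    imgMap θ (x.γ 0, x.γ 1) = (imgCol θ x, imgRow θ x) := by
  simp [imgMap, imgCol, imgRow, NavState.γ]

theorem exists_separating_bump {N : ℕ} {s : Fin N → ℝ} (hs : Function.Injective s) {p q : ℝ}
    (hsm : ∀ i, s i ∈ Ioo p q) (i : Fin N) :
    ∃ ψ : ℝ → ℝ, tsupport ψ ⊆ Ioo p q ∧ ContDiff ℝ ∞ ψ ∧ ψ (s i) = 1 ∧ ∀ j ≠ i, ψ (s j) = 0 := by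
  have hO : Ioo p q ∩ (s '' {i}ᶜ)ᶜ ∈ 𝓝 (s i) := by
    refine (isOpen_Ioo.inter ((toFinite _).isClosed.isOpen_compl)).mem_nhds ⟨hsm i, ?_⟩
    rintro ⟨j, hj, hji⟩
    exact hj (hs hji)
  obtain ⟨ψ, h1, -, h2, -, h3⟩ := exists_contDiff_tsupport_subset (n := ⊤) hO
  refine ⟨ψ, h1.trans inter_subset_left, h2, h3, fun j hj => ?_⟩
  refine image_eq_zero_of_notMem_tsupport fun h => (h1 h).2 ⟨j, hj, rfl⟩

/-- Finitely many image points of a landmark at positive depth can be moved off a set with dense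
complement by an arbitrarily small change of the input. -/
theorem samplesPerturbable {θ : Calib} (hq : θ.qCB ⬝ᵥ θ.qCB = 1) (hMa : θ.Ma.det ≠ 0)
    (hfx : θ.intr 0 ≠ 0) (hfy : θ.intr 1 ≠ 0) {C : Set AugState}
    (hC : ∀ w ∈ C, 0 < w.1.ρ ∧ w.2 = θ.toParams) {α β p q : ℝ} (hp : α < p) (hqβ : q < β) :
    SamplesPerturbable augDyn augCol augRow C α β p q := by
  intro u Y hY hYC N s hs hsm E hE U hU
  let x : ℝ → NavState := fun t => (Y t).1
  have hY2 : ∀ t ∈ Icc α β, (Y t).2.toCalib = θ := fun t ht => by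
    rw [(hC _ (hYC t ht)).2, Calib.toCalib_toParams]
  have hx : ∀ t ∈ Ioo α β, HasDerivAt x (dyn θ (x t) (u.val t)) t := fun t ht => by
    have h := hasDerivAt_fst_of_prod (hY.hasDerivAt ht)
    simp only [augDyn, hY2 t (Ioo_subset_Icc_self ht)] at h
    exact h
  have hsub : Ioo p q ⊆ Ioo α β := Ioo_subset_Ioo hp.le hqβ.le
  choose ψ hψs hψ hψ1 hψ0 using exists_separating_bump hs hsm
  have hvar := fun j : Fin N × Fin 2 => exists_isVariation hq hMa isOpen_Ioo hx
    (fun t ht => (hC _ (hYC t (Ioo_subset_Icc_self ht))).1.ne') (hψ j.1)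
    ((hψs j.1).trans hsub) (Pi.single j.2 1)
  choose w d hwd hwd0 using hvar
  have hoff : ∀ (i : Fin N) (t : ℝ), t ∉ Icc p q → t ∉ tsupport (ψ i) := fun i t ht h =>
    ht (Ioo_subset_Icc_self (hψs i h))
  have hcU : ∀ᶠ c in 𝓝 (0 : Fin N × Fin 2 → ℝ), u.addSum d c ∈ U := by
    refine (u.continuous_addSum d).continuousAt.eventually_mem ?_
    have : u.addSum d 0 = u := by
      simp [SmoothInput.addSum]
    rwa [this]
  obtain ⟨ε, hε, hεU⟩ := Metric.eventually_nhds_iff.mp hcU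
  let g : Fin N → ℝ × ℝ := fun i => ((x (s i)).γ 0, (x (s i)).γ 1)
  have hopen : IsOpen (univ.pi fun i => interior (imgMap θ '' Metric.ball (g i) ε)) :=
    isOpen_set_pi finite_univ fun _ _ => isOpen_interior
  -- Target samples outside `E` that are images of directions `ε`-close to the actual ones.
  obtain ⟨z, hzE, hz⟩ := hE.exists_mem_open hopen (univ_pi_nonempty_iff.mpr fun i =>
    interior_image_imgMap_nonempty hfx hfy (Metric.ball_mem_nhds (g i) hε))
  have hz' : ∀ i, ∃ a ∈ Metric.ball (g i) ε, imgMap θ a = z i := fun i =>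
    (interior_subset (hz i trivial) : z i ∈ imgMap θ '' Metric.ball (g i) ε)
  choose a ha haz using hz'
  -- As `ψ i` is 1 at `s i` and 0 at the other sample times, these coefficients move the direction
  -- at `s i` exactly to `a i`.
  let c : Fin N × Fin 2 → ℝ := fun j =>
    (![(a j.1).1 - (g j.1).1, (a j.1).2 - (g j.1).2] : Fin 2 → ℝ) j.2
  have hc : u.addSum d c ∈ U := by
    refine hεU ((dist_pi_lt_iff hε).mpr ?_)
    rintro ⟨i, k⟩
    have := ha i
    rw [Metric.mem_ball, Prod.dist_eq, max_lt_iff] at this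
    fin_cases k
    · simpa [c, Real.dist_eq] using this.1
    · simpa [c, Real.dist_eq] using this.2
  let η : ℝ → Fin 2 → ℝ := fun t => ∑ j, c j • (ψ j.1 t • Pi.single j.2 (1 : ℝ))
  let v : ℝ → V3 := fun t => ∑ j, c j • w j t
  have hv : IsVariation θ u.val x (Ioo α β) η v (fun t => ∑ j, c j • (d j).val t) :=
    IsVariation.sum Finset.univ c hwd
  have hη0 : ∀ t ∉ Icc p q, η t = 0 := fun t ht => Finset.sum_eq_zero fun j _ => by
    rw [image_eq_zero_of_notMem_tsupport (hoff j.1 t ht), zero_smul, smul_zero]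
  have hv0 : ∀ t ∉ Icc p q, v t = 0 := fun t ht => Finset.sum_eq_zero fun j _ => by
    rw [(hwd0 j t (hoff j.1 t ht)).1, smul_zero]
  have hu0 : ∀ t ∉ Icc p q, (u.addSum d c).val t = u.val t := fun t ht => by
    have : ∑ j, c j • (d j).val t = 0 := Finset.sum_eq_zero fun j _ => by
      rw [(hwd0 j t (hoff j.1 t ht)).2, smul_zero]
    simp only [SmoothInput.addSum, this, add_zero]
  let Z : ℝ → AugState := fun t => (IsVariation.shift (x t) (η t) (v t), (Y t).2)
  have hZY : ∀ t ∉ Icc p q, Z t = Y t := fun t ht => by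
    simp only [Z, IsVariation.shift, hη0 t ht, hv0 t ht, add_zero]
    rfl
  refine ⟨_, hc, hu0, Z, fun t ht => ?_, hZY, ?_⟩
  · by_cases htp : t ∈ Icc p q
    · have ht' : t ∈ Ioo α β := ⟨hp.trans_le htp.1, htp.2.trans_lt hqβ⟩
      have h1 := hv.hasDerivAt_shift ht' (hx t ht')
      have h2 := hasDerivAt_snd_of_prod (hY.hasDerivAt ht')
      have h3 := h1.prodMk h2
      simp only [augDyn] at h3 ⊢
      simp only [Z, hY2 t ht]
      exact h3.hasDerivWithinAt
    · have hev : ∀ᶠ τ in 𝓝 t, Z τ = Y τ :=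
        eventually_of_mem (isClosed_Icc.isOpen_compl.mem_nhds htp) fun τ hτ => hZY τ hτ
      rw [hu0 t htp, hZY t htp]
      exact (hY t ht).congr_of_eventuallyEq (hev.filter_mono nhdsWithin_le_nhds) hev.self_of_nhds
  · have hηs : ∀ i k, η (s i) k = c (i, k) := fun i k => by
      simp only [η, Finset.sum_apply, Pi.smul_apply, smul_eq_mul, Fintype.sum_prod_type]
      rw [Finset.sum_eq_single i (fun j _ hj => Finset.sum_eq_zero fun l _ => by
        rw [hψ0 j i hj.symm]; simp) (by simp), Finset.sum_eq_single k (fun l _ hl => by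
          simp [hl.symm]) (by simp)]
      simp [hψ1]
    have hZs : ∀ i, (augCol (Z (s i)), augRow (Z (s i))) = z i := fun i => by
      have hmem : s i ∈ Icc α β := Ioo_subset_Icc_self (hsub (hsm i))
      rw [← haz i]
      simp only [augCol, augRow, Z, hY2 _ hmem]
      rw [← imgMap_γ]
      congr 1
      ext
      · simp [IsVariation.shift, NavState.γ, hηs, c, g]
      · simp [IsVariation.shift, NavState.γ, hηs, c, g]
    rw [funext hZs]
    exact hzE

/-! ### Generic inputs and the recovery of the readout time. -/

theorem lipCurves_mono {W : Type*} [PseudoMetricSpace W] {C D : Set W} (hCD : C ⊆ D)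
    {M L : NNReal} (hML : M ≤ L) : lipCurves C M ⊆ lipCurves D L :=
  fun _ h => ⟨h.1.weaken hML, fun s => hCD (h.2 s)⟩

/-- Solutions on a compact interval extend to bounded Lipschitz curves. -/
theorem SolvesOn.exists_extension {W : Type*} [NormedAddCommGroup W] [NormedSpace ℝ W]
    {F : W × Input → W} (hF : Continuous F) {u : SmoothInput} {a b : ℝ} (hab : a ≤ b)
    {Y : ℝ → W} (hY : SolvesOn F u a b Y) :
    ∃ (Z : C(ℝ, W)) (n : ℕ), Z ∈ lipCurves (Y '' Icc a b ∩ Metric.closedBall 0 n) n ∧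
      EqOn Z Y (Icc a b) ∧ SolvesOn F u a b Z := by
  obtain ⟨R, hR⟩ :=
    (isCompact_Icc.image_of_continuousOn hY.continuousOn).isBounded.subset_closedBall 0
  have hc : ContinuousOn (fun t => F (Y t, u.val t)) (Icc a b) :=
    hF.comp_continuousOn (hY.continuousOn.prodMk u.continuous_val.continuousOn)
  obtain ⟨B, hB⟩ := (isCompact_Icc.image_of_continuousOn hc).isBounded.subset_closedBall 0
  obtain ⟨n, hn⟩ := exists_nat_ge (max R B)
  have hL : LipschitzOnWith n Y (Icc a b) := by
    refine (convex_Icc a b).lipschitzOnWith_of_nnnorm_hasDerivWithin_le hY fun t ht => ?_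
    have h1 := hB ⟨t, ht, rfl⟩
    rw [mem_closedBall_zero_iff] at h1
    rw [← NNReal.coe_le_coe]
    simpa using h1.trans ((le_max_right _ _).trans hn)
  -- The curve is frozen at its end values outside `[a, b]`.
  have hlip : LipschitzWith n (fun t => Y (projIcc a b hab t)) := by
    have := hL.to_restrict.comp (LipschitzWith.projIcc hab)
    simpa [Function.comp_def] using this
  have heq : EqOn (fun t => Y (projIcc a b hab t)) Y (Icc a b) := fun t ht => by
    simp only [projIcc_of_mem hab ht]
  refine ⟨⟨_, hlip.continuous⟩, n, ⟨hlip, fun s => ⟨⟨_, (projIcc a b hab s).2, rfl⟩, ?_⟩⟩, heq,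
    fun t ht => ?_⟩
  · exact Metric.closedBall_subset_closedBall ((le_max_left _ _).trans hn)
      (hR ⟨_, (projIcc a b hab s).2, rfl⟩)
  · have h1 : (fun t => Y (projIcc a b hab t)) t = Y t := heq ht
    simp only [ContinuousMap.coe_mk]
    rw [show Y (projIcc a b hab t) = Y t from h1]
    exact (hY t ht).congr heq h1

theorem solvesOn_augDyn {θ : Calib} {u : SmoothInput} {x : ℝ → NavState} {a b : ℝ}
    (hx : ∀ s ∈ Icc a b, HasDerivAt x (dyn θ (x s) (u.val s)) s) :
    SolvesOn augDyn u a b fun s => (x s, θ.toParams) := fun s hs =>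
  ((hx s hs).prodMk (hasDerivAt_const s θ.toParams)).hasDerivWithinAt

/-- The states with the constant parameters `θ` whose norm is at most `m` and whose inverse depth is
at least `(m + 1)⁻¹`. -/
def regularStates (θ : Calib) (m : ℕ) : Set AugState :=
  {w | w ∈ Metric.closedBall 0 m ∧ ((m : ℝ) + 1)⁻¹ ≤ w.1.ρ ∧ w.2 = θ.toParams}

theorem isCompact_regularStates (θ : Calib) (m : ℕ) : IsCompact (regularStates θ m) := by
  refine (isCompact_closedBall _ _).inter_right (IsClosed.inter ?_ ?_)
  · exact isClosed_le continuous_const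
      (continuous_fst.comp (continuous_snd.comp continuous_fst) :
        Continuous fun w : AugState => w.1.ρ)
  · exact isClosed_eq continuous_snd continuous_const

/-- The inputs for which the image sequence of the solution through `x₀` at time `s₀` is neither
constant in the row on an interval nor repeated elsewhere, in the sense of `matchedInputs`. -/
def IsGenericInput (θ : Calib) (s₀ : ℝ) (x₀ : NavState) (u : SmoothInput) : Prop :=
  ∀ (m : ℕ) (α β p q : ℚ), (α : ℝ) < s₀ → s₀ < β → α < p → p < q → q < β →
    s₀ ∉ Icc (p : ℝ) q →
    u ∉ constantRowInputs augDyn augRow s₀ (x₀, θ.toParams) (regularStates θ m) m α β p q ∧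
    ∀ p' q' : ℚ, Disjoint (Icc (p : ℝ) q) (Icc (p' : ℝ) q') →
      u ∉ matchedInputs augDyn augCol augRow s₀ (x₀, θ.toParams) (regularStates θ m)
        (Metric.closedBall 0 m) m α β p q p' q'

/-- Rational endpoints and integer bounds leave countably many conditions, each open and dense. -/
theorem eventually_isGenericInput {θ : Calib} (hq : θ.qCB ⬝ᵥ θ.qCB = 1) (hMa : θ.Ma.det ≠ 0)
    (hfx : θ.intr 0 ≠ 0) (hfy : θ.intr 1 ≠ 0) (s₀ : ℝ) (x₀ : NavState) :
    ∀ᶠ u in residual SmoothInput, IsGenericInput θ s₀ x₀ u := by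
  have hF := contDiff_augDyn
  have hcol := contDiff_augCol
  have hrow := contDiff_augRow
  have h1 : (1 : WithTop ℕ∞) ≤ ∞ := by exact_mod_cast le_top
  have hres : ∀ S : Set SmoothInput, IsClosed S → interior S = ∅ → ∀ᶠ u in residual _, u ∉ S :=
    fun S hS hi => residual_of_dense_open hS.isOpen_compl (interior_eq_empty_iff_dense_compl.mp hi)
  unfold IsGenericInput
  simp only [eventually_countable_forall, eventually_and]
  intro m α β p q hα hβ hp hpq hqβ hs
  have hP : SamplesPerturbable augDyn augCol augRow (regularStates θ m) α β p q :=
    samplesPerturbable hq hMa hfx hfy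
      (fun w hw => ⟨(by positivity : (0 : ℝ) < ((m : ℝ) + 1)⁻¹).trans_le hw.2.1, hw.2.2⟩)
      (by exact_mod_cast hp) (by exact_mod_cast hqβ)
  have hp' : (α : ℝ) < p := by exact_mod_cast hp
  have hpq' : (p : ℝ) < q := by exact_mod_cast hpq
  have hq' : (q : ℝ) < β := by exact_mod_cast hqβ
  refine ⟨hres _ ?_ ?_, fun p' q' hd => hres _ ?_ ?_⟩
  · exact isClosed_constantRowInputs hF.continuous hrow.continuous _ _
      (isCompact_regularStates θ m) _ _ _ _ _
  · exact interior_constantRowInputs (hF.of_le h1) hP ⟨hα, hβ⟩ hp' hpq' hq' hs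
  · exact isClosed_matchedInputs hF.continuous hcol.continuous hrow.continuous _ _
      (isCompact_regularStates θ m) (isCompact_closedBall _ _) _ _ _ _ _ _ _
  · exact interior_matchedInputs (hF.of_le h1) (hcol.of_le h1) hP ⟨hα, hβ⟩ hp' hpq' hq' hs hd

theorem exists_rat_Icc_subset {s : ℝ} {S : Set ℝ} (hS : S ∈ 𝓝 s) :
    ∃ p q : ℚ, (p : ℝ) < s ∧ s < q ∧ Icc (p : ℝ) q ⊆ S := by
  obtain ⟨ε, hε, h⟩ := Metric.mem_nhds_iff.mp hS
  obtain ⟨p, hp, hps⟩ := exists_rat_btwn (sub_lt_self s hε)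
  obtain ⟨q, hqs, hq⟩ := exists_rat_btwn (lt_add_of_pos_right s hε)
  refine ⟨p, q, hps, hqs, fun t ht => h ?_⟩
  rw [Metric.mem_ball, Real.dist_eq, abs_lt]
  exact ⟨by linarith [ht.1], by linarith [ht.2]⟩

/-- A solution for a generic input shows no images that another solution shows at times shifted in
proportion to the row, except at the same times. -/
theorem IsGenericInput.shift_eq {θ θ' : Calib} {s₀ : ℝ} {u : SmoothInput} {x x' : ℝ → NavState}
    (hu : IsGenericInput θ s₀ (x s₀) u) {a b a' b' : ℝ} (hs₀ : s₀ ∈ Ioo a b) (hρ : 0 < (x s₀).ρ)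
    (hx : ∀ s ∈ Ioo a b, HasDerivAt x (dyn θ (x s) (u.val s)) s)
    (hx' : ∀ s ∈ Ioo a' b', HasDerivAt x' (dyn θ' (x' s) (u.val s)) s) {s₁ : ℝ} (hs₁ : s₁ ≠ s₀)
    (hab : uIcc s₀ s₁ ⊆ Ioo a b) {c d : ℝ}
    (hφ : ∀ s ∈ uIcc s₀ s₁, s + c + d * imgRow θ (x s) ∈ Ioo a' b')
    (hcol : ∀ s ∈ uIcc s₀ s₁, imgCol θ (x s) = imgCol θ' (x' (s + c + d * imgRow θ (x s)))) :
    d = 0 := by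
  have hxc : ContinuousOn x (Ioo a b) := fun s hs => (hx s hs).continuousAt.continuousWithinAt
  have hrowx : ∀ s ∈ Ioo a b, ContinuousAt (fun s => imgRow θ (x s)) s := fun s hs => by
    have h1 : ContinuousAt (fun s => ((x s, θ.toParams) : AugState)) s :=
      (hx s hs).continuousAt.prodMk continuousAt_const
    have h2 := contDiff_augRow.continuous.continuousAt.comp h1
    exact h2
  have hρev : ∀ᶠ s in 𝓝 s₀, (x s).ρ ∈ Ioi ((x s₀).ρ / 2) := by
    have h1 : ContinuousAt (fun s => (x s).ρ) s₀ :=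
      (continuous_fst.comp continuous_snd).continuousAt.comp (hx s₀ hs₀).continuousAt
    exact h1.eventually_mem (Ioi_mem_nhds (half_lt_self hρ))
  obtain ⟨α, β, hα, hβ, hαβ⟩ := exists_rat_Icc_subset
    (hρev.and (Ioo_mem_nhds hs₀.1 hs₀.2))
  -- An open interval between `s₀` and `s₁`, adjacent to `s₀` without containing it, on which the
  -- inverse depth stays above half its value at `s₀`.
  obtain ⟨lo, hi, hlohi, hI⟩ : ∃ lo hi : ℝ, lo < hi ∧
      ∀ s ∈ Ioo lo hi, s ∈ uIcc s₀ s₁ ∧ (α : ℝ) < s ∧ s < β ∧ s ≠ s₀ := by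
    rcases lt_or_gt_of_ne hs₁ with h | h
    · refine ⟨max s₁ α, s₀, max_lt h hα, fun s hs => ?_⟩
      have := max_lt_iff.mp hs.1
      exact ⟨mem_uIcc.mpr (Or.inr ⟨this.1.le, hs.2.le⟩), this.2, hs.2.trans hβ, hs.2.ne⟩
    · refine ⟨s₀, min s₁ β, lt_min h hβ, fun s hs => ?_⟩
      have := lt_min_iff.mp hs.2
      exact ⟨mem_uIcc.mpr (Or.inl ⟨hs.1.le, this.1.le⟩), hα.trans hs.1, this.2, hs.1.ne'⟩
  obtain ⟨Y, n, hYn, hYx, hYs⟩ := (solvesOn_augDyn (θ := θ) (u := u) fun s hs =>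
    hx s (hαβ hs).2).exists_extension contDiff_augDyn.continuous (hα.trans hβ).le
  obtain ⟨k, hk⟩ := exists_nat_ge ((x s₀).ρ / 2)⁻¹
  have hYreg : ∀ m : ℕ, max n k ≤ m → Y ∈ lipCurves (regularStates θ m) m := fun m hm => by
    refine lipCurves_mono ?_ (Nat.cast_le.mpr ((le_max_left n k).trans hm)) hYn
    rintro _ ⟨⟨s, hs, rfl⟩, hw⟩
    refine ⟨Metric.closedBall_subset_closedBall
      (Nat.cast_le.mpr ((le_max_left n k).trans hm)) hw, ?_, rfl⟩
    have h1 : (x s₀).ρ / 2 < (x s).ρ := (hαβ hs).1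
    refine le_trans ?_ h1.le
    rw [inv_le_comm₀ (by positivity) (half_pos hρ)]
    have h2 : (k : ℝ) ≤ m := Nat.cast_le.mpr ((le_max_right n k).trans hm)
    linarith
  have hY₀ : Y s₀ = (x s₀, θ.toParams) := hYx ⟨hα.le, hβ.le⟩
  have hYrow : ∀ s ∈ Ioo lo hi, Y s = (x s, θ.toParams) := fun s hs =>
    hYx ⟨(hI s hs).2.1.le, (hI s hs).2.2.1.le⟩
  -- If some time is moved, the input is in `matchedInputs`; if none is and `d ≠ 0`, the row is
  -- constant and the input is in `constantRowInputs`.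
  by_cases hcase : ∃ s ∈ Ioo lo hi, s + c + d * imgRow θ (x s) ≠ s
  · exfalso
    obtain ⟨s, hs, hne⟩ := hcase
    set φ : ℝ → ℝ := fun s => s + c + d * imgRow θ (x s) with hφdef
    have hsI := (hI s hs).1
    -- Balls of half the distance around `s` and `φ s` are disjoint.
    have hδ : 0 < |φ s - s| / 2 := half_pos (abs_pos.mpr (sub_ne_zero.mpr hne))
    obtain ⟨p', q', hp', hq', hpq'⟩ := exists_rat_Icc_subset (s := φ s) (inter_mem
      (Ioo_mem_nhds (hφ s hsI).1 (hφ s hsI).2) (Metric.ball_mem_nhds (φ s) hδ))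
    have hφc : ContinuousAt φ s :=
      (continuousAt_id.add continuousAt_const).add (continuousAt_const.mul (hrowx s (hab hsI)))
    obtain ⟨p, q, hp, hq, hpq⟩ := exists_rat_Icc_subset (s := s) (inter_mem
      (inter_mem (Ioo_mem_nhds hs.1 hs.2) (Metric.ball_mem_nhds s hδ))
      (hφc.preimage_mem_nhds (Icc_mem_nhds hp' hq')))
    obtain ⟨Z, l, hZl, hZx, hZs⟩ := (solvesOn_augDyn (θ := θ') (u := u) fun s hs =>
      hx' s (hpq' hs).1).exists_extension contDiff_augDyn.continuous (hp'.trans hq').le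
    obtain ⟨e, he⟩ := exists_nat_ge (max |c| |d|)
    obtain ⟨m, hm1, hm2, hm3⟩ : ∃ m : ℕ, max n k ≤ m ∧ l ≤ m ∧ e ≤ m :=
      ⟨max (max n k) (max l e), le_max_left _ _, (le_max_left _ _).trans (le_max_right _ _),
        (le_max_right _ _).trans (le_max_right _ _)⟩
    have hem : (e : ℝ) ≤ m := Nat.cast_le.mpr hm3
    have hpI : (p : ℝ) ∈ Icc (p : ℝ) q := ⟨le_rfl, (hp.trans hq).le⟩
    have hqI : (q : ℝ) ∈ Icc (p : ℝ) q := ⟨(hp.trans hq).le, le_rfl⟩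
    refine (hu m α β p q hα hβ ?_ ?_ ?_ ?_).2 p' q' ?_ ⟨Y, hYreg m hm1, Z, ?_, c, ?_, d, ?_,
      hY₀, hYs, hZs, fun t ht => ?_⟩
    · exact_mod_cast (hI p (hpq hpI).1.1).2.1
    · exact_mod_cast hp.trans hq
    · exact_mod_cast (hI q (hpq hqI).1.1).2.2.1
    · exact fun h => (hI s₀ (hpq h).1.1).2.2.2 rfl
    · refine disjoint_left.mpr fun t ht ht' => ?_
      have h1 : |t - s| < _ := (hpq ht).1.2
      have h2 : |t - φ s| < _ := (hpq' ht').2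
      have h3 := abs_sub_le (φ s) t s
      rw [abs_sub_comm (φ s) t] at h3
      linarith
    · refine lipCurves_mono ?_ (Nat.cast_le.mpr hm2) hZl
      exact inter_subset_right.trans (Metric.closedBall_subset_closedBall (Nat.cast_le.mpr hm2))
    · have := abs_le.mp ((le_max_left |c| |d|).trans (he.trans hem))
      exact ⟨by simpa using this.1, by simpa using this.2⟩
    · have := abs_le.mp ((le_max_right |c| |d|).trans (he.trans hem))
      exact ⟨by simpa using this.1, by simpa using this.2⟩
    · have htI := (hpq ht).1.1
      have hφt : φ t ∈ Icc (p' : ℝ) q' := (hpq ht).2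
      rw [hYrow t htI]
      have hr : augRow (x t, θ.toParams) = imgRow θ (x t) := rfl
      rw [hr]
      refine ⟨hφt, ?_⟩
      have h2 := hZx hφt
      simp only [hφdef] at h2
      rw [h2]
      exact hcol t (hI t htI).1
  · push Not at hcase
    by_contra hd
    obtain ⟨p, hp, hp'⟩ := exists_rat_btwn hlohi
    obtain ⟨q, hq, hq'⟩ := exists_rat_btwn hp'
    have hsub : ∀ t ∈ Icc (p : ℝ) q, t ∈ Ioo lo hi := fun t ht =>
      ⟨hp.trans_le ht.1, ht.2.trans_lt hq'⟩
    have hpI : (p : ℝ) ∈ Icc (p : ℝ) q := ⟨le_rfl, hq.le⟩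
    have hqI : (q : ℝ) ∈ Icc (p : ℝ) q := ⟨hq.le, le_rfl⟩
    refine (hu (max n k) α β p q hα hβ ?_ ?_ ?_ ?_).1 ⟨Y, hYreg _ le_rfl, hY₀, hYs, fun t ht => ?_⟩
    · exact_mod_cast (hI p (hsub p hpI)).2.1
    · exact_mod_cast hq
    · exact_mod_cast (hI q (hsub q hqI)).2.2.1
    · exact fun h => (hI s₀ (hsub s₀ h)).2.2.2 rfl
    · rw [hYrow t (hsub t ht), hYrow p (hsub p hpI)]
      have h1 := hcase t (hsub t ht)
      have h2 := hcase p (hsub p hpI)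
      have h3 : d * (imgRow θ (x t) - imgRow θ (x p)) = 0 := by linarith
      exact sub_eq_zero.mp ((mul_eq_zero.mp h3).resolve_left hd)

/-- For a generic input, the records of the image determine the readout time. -/
theorem IsGenericInput.readout_eq {H κ t₀ T : ℝ} (hH : 0 < H) (hT : 0 < T) {ξ ξ' : FullState}
    (hρ : 0 < ξ.nav.ρ) {u : SmoothInput}
    (hu : IsGenericInput ξ.cal (rsTime H κ ξ t₀ (imgRow ξ.cal ξ.nav)) ξ.nav u)
    {y : ℝ → Fin 2 → ℝ} (hy : IsRecord (n := 0) imageObs H κ t₀ T ξ u y)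
    (hy' : IsRecord (n := 0) imageObs H κ t₀ T ξ' u y) : ξ'.tr = ξ.tr := by
  obtain ⟨hyc, a, b, x, hx, hmem, hx₀, hobs⟩ := hy
  obtain ⟨-, a', b', x', hx', hmem', -, hobs'⟩ := hy'
  let σ : ℝ → ℝ := fun t => rsTime H κ ξ t (y t 1)
  have ht₀ : t₀ ∈ Icc t₀ (t₀ + T) := ⟨le_rfl, by linarith⟩
  have ht₁ : t₀ + T ∈ Icc t₀ (t₀ + T) := ⟨by linarith, le_rfl⟩
  have hrow : ∀ t ∈ Icc t₀ (t₀ + T), y t 1 = imgRow ξ.cal (x (σ t)) := fun t ht =>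
    congrFun (hobs t ht) 1
  -- The IMU time of the first observation depends on `ξ` alone, so the meagre set can be chosen
  -- independently of the record and of `T`.
  have hσ₀ : σ t₀ = rsTime H κ ξ t₀ (imgRow ξ.cal ξ.nav) := by
    have h1 := hrow t₀ ht₀
    rw [show x (σ t₀) = ξ.nav from hx₀] at h1
    simp only [σ, h1]
  have hσc : ContinuousOn σ (Icc t₀ (t₀ + T)) := by
    have h1 : ContinuousOn (fun t => y t 1) (Icc t₀ (t₀ + T)) := continuousOn_pi.mp hyc 1
    simp only [σ, rsTime]
    fun_prop
  -- Equal IMU times would show equal rows, and then equal camera times. Hence `σ` covers a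
  -- nondegenerate interval; it need not be injective, since the record depends on `t` only through
  -- `σ t`.
  have hne : σ (t₀ + T) ≠ σ t₀ := fun h => by
    have h1 : y (t₀ + T) 1 = y t₀ 1 := by rw [hrow _ ht₁, hrow _ ht₀, h]
    simp only [σ, rsTime, h1] at h
    linarith
  have hsub : uIcc (σ t₀) (σ (t₀ + T)) ⊆ σ '' Icc t₀ (t₀ + T) :=
    ((isPreconnected_Icc.image σ hσc).ordConnected).uIcc_subset ⟨_, ht₀, rfl⟩ ⟨_, ht₁, rfl⟩
  -- The observation time under `ξ'` as a function of the one under `ξ`: this is the map `φ` with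
  -- its constants `c` and `d`.
  have hφ : ∀ t ∈ Icc t₀ (t₀ + T),
      σ t + (ξ'.td - ξ.td - κ * (ξ'.tr - ξ.tr)) +
        (ξ'.tr - ξ.tr) / H * imgRow ξ.cal (x (σ t)) = rsTime H κ ξ' t (y t 1) := fun t ht => by
    rw [← hrow t ht]
    simp only [σ, rsTime]
    ring
  rw [← hσ₀, ← hx₀] at hu
  have hd := hu.shift_eq (θ' := ξ'.cal) (x' := x') (s₁ := σ (t₀ + T)) (hmem _ ht₀)
    (by rw [show x (σ t₀) = ξ.nav from hx₀]; exact hρ) hx hx' hne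
    (hsub.trans (image_subset_iff.mpr hmem)) (c := ξ'.td - ξ.td - κ * (ξ'.tr - ξ.tr))
    (d := (ξ'.tr - ξ.tr) / H) (fun s hs => ?_) (fun s hs => ?_)
  · rw [div_eq_zero_iff, or_iff_left hH.ne', sub_eq_zero] at hd
    exact hd
  · obtain ⟨t, ht, rfl⟩ := hsub hs
    rw [hφ t ht]
    exact hmem' t ht
  · obtain ⟨t, ht, rfl⟩ := hsub hs
    rw [hφ t ht]
    exact (congrFun (hobs t ht) 0).symm.trans (congrFun (hobs' t ht) 0)

theorem IsRecord.image {H κ t₀ T : ℝ} {ξ : FullState} {u : SmoothInput} {y : ℝ → Fin 4 → ℝ}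
    (hy : IsRecord (n := 2) fullObs H κ t₀ T ξ u y) :
    IsRecord (n := 0) imageObs H κ t₀ T ξ u fun t => ![y t 0, y t 1] := by
  obtain ⟨hyc, a, b, x, hx, hmem, hx₀, hobs⟩ := hy
  refine ⟨?_, a, b, x, hx, hmem, hx₀, fun t ht => ?_⟩
  · have h := continuousOn_pi.mp hyc
    refine continuousOn_pi.mpr fun i => ?_
    fin_cases i
    · exact h 0
    · exact h 1
  · ext i
    fin_cases i
    · exact congrFun (hobs t ht) 0
    · exact congrFun (hobs t ht) 1

/-- A change of the readout time can be compensated by the time offset if the record is constant. -/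
theorem readoutUnobservableIfConstant {n : ℕ} (h : Calib → NavState → Fin (n + 2) → ℝ)
    (H κ t₀ : ℝ) (ξ : FullState) : ReadoutUnobservableIfConstant h H κ t₀ ξ := by
  rintro u T - y ⟨hyc, a, b, x, hx, hmem, hx₀, hobs⟩ hconst ⟨N, hN, hobsv⟩
  -- The offset change cancels `ε` times the row factor, which is the same throughout the record.
  let p : ℝ → FullState := fun ε =>
    (ξ.nav, ξ.cal, ξ.td - (y t₀ 1 / H - κ) * ε, ξ.tr + ε)
  have hp : Continuous p := by fun_prop
  have hp0 : p 0 = ξ := by simp [p]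
  have hev : ∀ᶠ ε in 𝓝 (0 : ℝ), p ε ∈ N := hp.continuousAt.eventually_mem (by rwa [hp0])
  obtain ⟨ε, hε, hε0⟩ := ((hev.filter_mono nhdsWithin_le_nhds).and
    (self_mem_nhdsWithin (s := {(0 : ℝ)}ᶜ))).exists
  have htime : ∀ t, y t 1 = y t₀ 1 → rsTime H κ (p ε) t (y t 1) = rsTime H κ ξ t (y t 1) := by
    intro t ht
    simp only [rsTime, p, ht]
    ring
  have htime' : ∀ t ∈ Icc t₀ (t₀ + T),
      rsTime H κ (p ε) t (y t 1) = rsTime H κ ξ t (y t 1) := fun t ht =>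
    htime t (congrFun (hconst t ht) 1)
  have htr := hobsv (p ε) hε ⟨hyc, a, b, x, hx, fun t ht => by rw [htime' t ht]; exact hmem t ht,
    by rw [htime t₀ rfl]; exact hx₀, fun t ht => by rw [htime' t ht]; exact hobs t ht⟩
  change ξ.tr + ε = ξ.tr at htr
  exact hε0 (by simpa using htr)

end RSVIO

end

theorem corollary1 (H κ t₀ : ℝ) (hH : 0 < H) (ξ : RSVIO.FullState) :
    (ξ.Regular →
      RSVIO.ReadoutGenericallyObservable RSVIO.imageObs H κ t₀ ξ ∧
      RSVIO.ReadoutGenericallyObservable RSVIO.fullObs H κ t₀ ξ) ∧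
    (RSVIO.ReadoutUnobservableIfConstant RSVIO.imageObs H κ t₀ ξ ∧
      RSVIO.ReadoutUnobservableIfConstant RSVIO.fullObs H κ t₀ ξ) := by
  refine ⟨fun hξ => ?_, RSVIO.readoutUnobservableIfConstant _ H κ t₀ ξ,
    RSVIO.readoutUnobservableIfConstant _ H κ t₀ ξ⟩
  have hgen := RSVIO.eventually_isGenericInput hξ.quat hξ.acc hξ.focal_x.ne' hξ.focal_y.ne'
    (RSVIO.rsTime H κ ξ t₀ (RSVIO.imgRow ξ.cal ξ.nav)) ξ.nav
  -- The neighbourhood is the whole space: generic inputs determine the readout time globally.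
  refine ⟨hgen.mono fun u hu T hT y hy => ⟨univ, univ_mem, fun ξ' _ hy' => ?_⟩,
    hgen.mono fun u hu T hT y hy => ⟨univ, univ_mem, fun ξ' _ hy' => ?_⟩⟩
  · exact hu.readout_eq hH hT hξ.depth hy hy'
  · exact hu.readout_eq hH hT hξ.depth hy.image hy'.image
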